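/- Let $n\ge 1$, let $K_n$ be the $(-2,3,2n+1)$-pretzel knot and $G(K_n)=\pi_1(S^3\setminus K_n)$ its knot group. It is generated by two meridians $a,b$ and an element $x$ with defining relations $$w^{-1}x=x\,b\,w^{-1}(axb)^{-1}x\,b,\qquad x=w^n,\qquad\text{where } w=a\,x\,b\,a\,(xb)^{-1}.$$ In terms of the standard pretzel diagram, whose three two-strand columns have $-2,3,2n+1$ crossings, $a$ and $b$ are the meridians (oriented downwards) of the top left strands of the first and second columns, and $x$ is the $n$-th power of the loop $w$ around the two parallel strands of the third column. Let $m,s$ be non-zero complex numbers such that $$\begin{aligned}0={}& m^8(s-1)(s+1)^2(s^{2n}-s^2)s^{2n+2}\\ &-m^6\{s^{6n+3}+(2s^6+s^5-4s^4+s^3+s^2-s-1)s^{4n+1}-(s^6+s^5-s^4-s^3+4s^2-s-2)s^{2n+2}+s^6\}\\ &+m^4\{(s^2+1)s^{6n+2}+(s^6+2s^5-3s^4-2s^3+6s^2-4s-2)s^{4n+3}\\ &\qquad-(2s^6+4s^5-6s^4+2s^3+3s^2-2s-1)s^{2n}+(s^2+1)s^5\}\\ &-m^2\{s^{6n+3}+(2s^6+s^5-4s^4+s^3+s^2-s-1)s^{4n+1}-(s^6+s^5-s^4-s^3+4s^2-s-2)s^{2n+2}+s^6\}\\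 &+(s-1)(s+1)^2(s^{2n}-s^2)s^{2n+2},\end{aligned}$$ and put $$\begin{aligned}\alpha={}&(s^2-1)s^{2n}\{-m^6(s-1)s^2(s^{2n+1}+1)+m^4(s^{2n+2}(s^4-2s^2+3s-1)+s^4-3s^3+2s^2-1)\\ &\qquad-m^2s(s^{2n}(2s^3-s^2+1)-s(s^3-s+2))+s^2(s^{2n}-s^2)\},\\ \beta={}&m^7s^{2n+2}(s^2-1)(s^3+1)\\ &-m^5s^3\{s^{4n}(s^3-s^2+1)+s^{2n-2}(s-1)(s^3+s+1)(s^3+s^2+1)-(s^3-s+1)\}\\ &+m^3s^2(s^3+1)(s^{2n}-1)(s^{2n}+s^2)-ms^3(s^{2n}-s^2)(s^{2n}+s),\\ H={}&1-m^2s+m^2s^{2n+1}-s^{2n+2},\\ \eta_1={}&m\alpha-ms^{2n+1}\alpha+s^{2n}\beta+m^2s^{2n}\beta,\\ \eta_2={}&-ms\alpha+ms^{2n+1}\alpha-s^{2n}\beta-s^{2n+1}\beta.\end{aligned}$$ Assume that $\alpha$, $\beta$, $s^{2n+1}+1$ and $H$ are non-zero (so that the formulas below make sense). Then there is exactly one representation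 $\rho_m:G(K_n)\to SL_2(\mathbb C)$ with $$\rho_m(a)=\begin{pmatrix}m&-\frac{(m^2-s)(s^{2n+1}+1)}{m(s+1)}\\0&m^{-1}\end{pmatrix},\quad \rho_m(b)=\frac1{s\alpha}\begin{pmatrix}\beta&-\frac{(s\alpha-m\beta)(ms\alpha-\beta)}{m\beta}\\ \beta&\frac{m(ms\alpha-\beta)+s\alpha}{m}\end{pmatrix},\quad \rho_m(x)=\begin{pmatrix}s^n&0\\ \frac{s^n-s^{-n}}{s^{2n+1}+1}&s^{-n}\end{pmatrix}.$$ Wada's twisted Alexander polynomial of a presentation $\langle x_0,\dots,x_k\mid r_1,\dots,r_k\rangle$ of $G(K_n)$ with respect to $\rho_m$ is the quotient $\det A_{\rho_m,j}/\det\Phi(x_j-1)$ for an index $j$ with non-zero denominator, where $\Phi(g)=t^{\mathrm{ab}(g)}\rho_m(g)$ with $\mathrm{ab}:G(K_n)\to\mathbb Z$ the abelianization sending $a,b$ to $1$, extended linearly to the group ring, and $A_{\rho_m,j}$ is the block matrix $(\Phi(\partial r_i/\partial x_l))_{i,l}$ of Fox derivatives with its $j$-th block column removed. For the presentation read off from the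 standard pretzel diagram (its generators $y_0,y_1,y_2$ are the meridians of the three arcs at the top, and its two relations come from two of the three arcs at the bottom), the denominator is non-zero for every $j$, and for every $j$ the quotient is, up to a factor $t^{2e}$ with $e\in\mathbb Z$ independent of $j$, equal to $$\Delta_{K_n,\rho_m}(t)=1+\sum_{i=0}^{2n-1}\lambda_i\,(t^{i+3}+t^{4n-i+3})+t^{4n+6},$$ where $$\lambda_i=\begin{cases}\dfrac{(1+m^2)\bigl(Hs^{i/2+1}\beta-s(s^{i/2+1}-s^{-(i/2+1)})(\eta_1+\eta_2)\bigr)}{Hm\beta}&\text{if }0\le i\le 2n-2,\ i\text{ even},\\[2ex] \dfrac{s^{(i-1)/2}-s^{-(i-1)/2}}{s-s^{-1}}&\text{if }0\le i\le 2n-2,\ i\text{ odd},\\[2ex] \dfrac{s^{n-1}-s^{-(n-1)}}{s-s^{-1}}-\dfrac{(s^2-1)\eta_1}{Hs^n\beta}&\text{if }i=2n-1.\end{cases}$$ In particular, $\Delta_{K_n,\rho_m}(t)$ is a monic polynomial of degree $4n+6$. -/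

import Mathlib

open scoped LaurentPolynomial

namespace PretzelTAP

/-! ### Fox calculus and Wada's invariant -/

/-- The homomorphism `g ↦ !![g, ∂g/∂x_j; 0, 1]` on the free group, given on generators by
`x_i ↦ !![x_i, δ_ij; 0, 1]`. -/
noncomputable def foxHom {N : ℕ} (j : Fin N) :
    FreeGroup (Fin N) →*
      (Matrix (Fin 2) (Fin 2) (MonoidAlgebra ℤ (FreeGroup (Fin N))))ˣ :=
  FreeGroup.lift fun i =>
    { val := !![MonoidAlgebra.of ℤ _ (FreeGroup.of i), if i = j then 1 else 0; 0, 1]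
      inv := !![MonoidAlgebra.of ℤ _ (FreeGroup.of i)⁻¹,
                if i = j then -MonoidAlgebra.of ℤ _ (FreeGroup.of i)⁻¹ else 0; 0, 1]
      val_inv := by
        ext a b
        fin_cases a <;> fin_cases b <;> split_ifs <;>
          simp [Matrix.mul_apply, Fin.sum_univ_two, MonoidAlgebra.one_def,
            MonoidAlgebra.single_mul_single]
      inv_val := by
        ext a b
        fin_cases a <;> fin_cases b <;> split_ifs <;>
          simp [Matrix.mul_apply, Fin.sum_univ_two, MonoidAlgebra.one_def,
            MonoidAlgebra.single_mul_single] }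

/-- The Fox derivative `∂g/∂x_j ∈ ℤΓ` of an element `g` of the free group `Γ`; see
`foxDeriv_of` and `foxDeriv_mul` for its two characterizing properties. -/
noncomputable def foxDeriv {N : ℕ} (j : Fin N) (g : FreeGroup (Fin N)) :
    MonoidAlgebra ℤ (FreeGroup (Fin N)) :=
  (foxHom j g).val 0 1

theorem foxDeriv_of {N : ℕ} (i j : Fin N) :
    foxDeriv j (FreeGroup.of i) = if i = j then 1 else 0 := by
  simp [foxDeriv, foxHom]

theorem foxHom_entries {N : ℕ} (j : Fin N) (g : FreeGroup (Fin N)) :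
    (foxHom j g).val 0 0 = MonoidAlgebra.of ℤ _ g ∧ (foxHom j g).val 1 0 = 0 ∧
      (foxHom j g).val 1 1 = 1 := by
  induction g using FreeGroup.induction_on with
  | C1 => simp [MonoidAlgebra.one_def]
  | of i => simp [foxHom]
  | inv_of i _ => simp [foxHom]
  | mul x y hx hy =>
    obtain ⟨h1, h2, h3⟩ := hx
    obtain ⟨k1, k2, k3⟩ := hy
    simp [Matrix.mul_apply, Fin.sum_univ_two, h1, h2, h3, k1, k2, k3]

theorem foxDeriv_mul {N : ℕ} (j : Fin N) (g h : FreeGroup (Fin N)) :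
    foxDeriv j (g * h) = foxDeriv j g + MonoidAlgebra.of ℤ _ g * foxDeriv j h := by
  have h1 := (foxHom_entries j g).1
  have h2 := (foxHom_entries j h).2.2
  simp only [foxDeriv, map_mul, Units.val_mul, Matrix.mul_apply, Fin.sum_univ_two, h1, h2, mul_one]
  rw [add_comm]

/-- The group `⟨x_0, …, x_k ∣ r_0, …, r_{k-1}⟩`. -/
abbrev Group1 {k : ℕ} (r : Fin k → FreeGroup (Fin (k + 1))) : Type :=
  PresentedGroup (Set.range r)

/-- `g ↦ t^{α(g)} ρ(g)`, for a linear representation `ρ` and a homomorphism `α` to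
the infinite cyclic group `⟨t⟩`. -/
noncomputable def twist {G : Type*} [Group G] {F : Type*} [Field F] {d : ℕ}
    (ρ : G →* GL (Fin d) F) (α : G →* Multiplicative ℤ) :
    G →* Matrix (Fin d) (Fin d) F[T;T⁻¹] where
  toFun g := (LaurentPolynomial.T (Multiplicative.toAdd (α g)) : F[T;T⁻¹]) •
    (ρ g : Matrix (Fin d) (Fin d) F).map LaurentPolynomial.C
  map_one' := by simp
  map_mul' g h := by
    rw [map_mul α, map_mul ρ, toAdd_mul, LaurentPolynomial.T_add, Units.val_mul, Matrix.map_mul,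
      smul_mul_smul_comm]

section Wada

variable {k d : ℕ} {F : Type*} [Field F] (r : Fin k → FreeGroup (Fin (k + 1)))
  (ρ : Group1 r →* GL (Fin d) F) (α : Group1 r →* Multiplicative ℤ)

/-- The ring homomorphism `Φ = (ρ̃ ⊗ α̃) ∘ φ : ℤΓ → M_d(F[t, t⁻¹])`. -/
noncomputable def wadaPhi :
    MonoidAlgebra ℤ (FreeGroup (Fin (k + 1))) →ₐ[ℤ] Matrix (Fin d) (Fin d) F[T;T⁻¹] :=
  MonoidAlgebra.lift ℤ _ _ ((twist ρ α).comp (PresentedGroup.mk (Set.range r)))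

/-- The matrix `A_{ρ,j}`: the block matrix `(Φ(∂r_i/∂x_l))` with its `j`-th block column removed. -/
noncomputable def wadaMatrix (j : Fin (k + 1)) : Matrix (Fin k × Fin d) (Fin k × Fin d) F[T;T⁻¹] :=
  Matrix.of fun a b => wadaPhi r ρ α (foxDeriv (j.succAbove b.1) (r a.1)) a.2 b.2

/-- The denominator `det Φ(x_j - 1)`. -/
noncomputable def wadaDenom (j : Fin (k + 1)) : F[T;T⁻¹] :=
  (wadaPhi r ρ α (MonoidAlgebra.of ℤ _ (FreeGroup.of j) - 1)).det

/-- The twisted Alexander polynomial `det A_{ρ,j} / det Φ(x_j - 1)` (defined when the denominator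
is not zero), an element of the field of fractions of `F[t, t⁻¹]`. -/
noncomputable def twistedAlexander (j : Fin (k + 1)) : FractionRing F[T;T⁻¹] :=
  algebraMap _ _ (wadaMatrix r ρ α j).det / algebraMap _ _ (wadaDenom r ρ α j)

end Wada

/-! ### Pretzel knots

The standard diagram of the pretzel link `P(p₀, p₁, p₂)` consists of three vertical two-strand
columns, the `j`-th one with `p_j` crossings (half twists, with sign), in which the right strand of
a column is joined to the left strand of the next one (cyclically) by an arc at the top and by an
arc at the bottom. Each strand at a given height defines an element of the link group, the meridian
of that strand oriented downwards; these are related by the Wirtinger relations at the crossings. -/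

/-- The effect of one half twist on the pair (left meridian, right meridian): the left strand passes
over to the right and keeps its meridian, the right strand passes under it, and its meridian is
conjugated. The inverse is the half twist with the opposite crossing. -/
def halfTwist (G : Type*) [Group G] : Equiv.Perm (G × G) where
  toFun q := (q.1 * q.2 * q.1⁻¹, q.1)
  invFun q := (q.2, q.2⁻¹ * q.1 * q.2)
  left_inv q := by ext <;> simp [mul_assoc]
  right_inv q := by ext <;> simp [mul_assoc]

/-- The meridians at the bottom of the `j`-th column. The generator `y_j` is the meridian of the
arc at the top joining column `j` to column `j + 1`: it is the (downwards) meridian of the top left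
strand of column `j + 1`, and its inverse is that of the top right strand of column `j`. -/
def pretzelBottom (p : Fin 3 → ℤ) (j : Fin 3) : FreeGroup (Fin 3) × FreeGroup (Fin 3) :=
  (halfTwist (FreeGroup (Fin 3)) ^ p j)
    (FreeGroup.of (j - 1), (FreeGroup.of j)⁻¹)

/-- The relation imposed by the arc at the bottom joining column `j` to column `j + 1`. -/
def pretzelRel (p : Fin 3 → ℤ) (j : Fin 3) : FreeGroup (Fin 3) :=
  (pretzelBottom p j).2 * (pretzelBottom p (j + 1)).1

/-- The relators of the link group of `P(p₀, p₁, p₂)`. As usual for a presentation read off from a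
diagram, one relation is redundant (`pretzelRel_two`) and is left out. -/
def pretzelRelators (p : Fin 3 → ℤ) : Fin 2 → FreeGroup (Fin 3) :=
  ![pretzelRel p 0, pretzelRel p 1]

theorem halfTwist_zpow_prod {G : Type*} [Group G] (z : ℤ) (q : G × G) :
    ((halfTwist G ^ z) q).1 * ((halfTwist G ^ z) q).2 = q.1 * q.2 := by
  have h1 : ∀ q : G × G, (halfTwist G q).1 * (halfTwist G q).2 = q.1 * q.2 := fun q => by
    simp [halfTwist]
  induction z using Int.induction_on generalizing q with
  | zero => simp
  | succ i ih => rw [zpow_add_one, Equiv.Perm.mul_apply, ih, h1]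
  | pred i ih =>
    rw [zpow_sub_one, Equiv.Perm.mul_apply, ih, ← h1 ((halfTwist G)⁻¹ q)]
    simp

theorem pretzelRel_prod (p : Fin 3 → ℤ) :
    pretzelRel p 2 = (pretzelRel p 0 * pretzelRel p 1)⁻¹ := by
  have hp : ∀ j : Fin 3, (pretzelBottom p j).1 * (pretzelBottom p j).2 =
      FreeGroup.of (j - 1) * (FreeGroup.of j)⁻¹ := fun j => halfTwist_zpow_prod _ _
  have h0 := hp 0
  have h1 := hp 1
  have h2 := hp 2
  rw [show (0 : Fin 3) - 1 = 2 from rfl] at h0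
  rw [show (1 : Fin 3) - 1 = 0 from rfl] at h1
  rw [show (2 : Fin 3) - 1 = 1 from rfl] at h2
  have tot : ∀ (l0 r0 l1 r1 l2 r2 u v w : FreeGroup (Fin 3)), l0 * r0 = w * u⁻¹ →
      l1 * r1 = u * v⁻¹ → l2 * r2 = v * w⁻¹ →
      r2 * l0 = (r0 * l1 * (r1 * l2))⁻¹ := by
    intro l0 r0 l1 r1 l2 r2 u v w a b c
    have t : l0 * r0 * (l1 * r1) * (l2 * r2) = 1 := by rw [a, b, c]; group
    have t' : r0 * l1 * (r1 * l2) * (r2 * l0) = l0⁻¹ * (l0 * r0 * (l1 * r1) * (l2 * r2)) * l0 := by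
      group
    rw [t] at t'
    rw [eq_inv_iff_mul_eq_one, mul_eq_one_comm, t']
    group
  exact tot _ _ _ _ _ _ _ _ _ h0 h1 h2

/-- The remaining relation holds in the group defined by the other two. -/
theorem pretzelRel_two (p : Fin 3 → ℤ) :
    (PresentedGroup.mk (Set.range (pretzelRelators p)) (pretzelRel p 2)) = 1 := by
  have e0 : PresentedGroup.mk (Set.range (pretzelRelators p)) (pretzelRel p 0) = 1 :=
    PresentedGroup.one_of_mem ⟨0, rfl⟩
  have e1 : PresentedGroup.mk (Set.range (pretzelRelators p)) (pretzelRel p 1) = 1 :=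
    PresentedGroup.one_of_mem ⟨1, rfl⟩
  rw [pretzelRel_prod, map_inv, map_mul, e0, e1]
  simp

/-! ### The knot `K_n = P(-2, 3, 2n+1)` -/

/-- The twists of the `(-2, 3, 2n+1)`-pretzel knot. -/
def knotTwists (n : ℕ) : Fin 3 → ℤ := ![-2, 3, 2 * n + 1]

/-- The relators of the knot group of `K_n`. -/
def knotRelators (n : ℕ) : Fin 2 → FreeGroup (Fin 3) := pretzelRelators (knotTwists n)

/-- The knot group `G(K_n)`. -/
abbrev KnotGroup (n : ℕ) : Type := Group1 (knotRelators n)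

/-- The generators `y_j` of `G(K_n)`. -/
def genY (n : ℕ) (j : Fin 3) : KnotGroup n := PresentedGroup.of j

/-- The meridian `a`: the left strand of the first column, at the top. -/
def genA (n : ℕ) : KnotGroup n := genY n 2

/-- The meridian `b`: the left strand of the second column, at the top. -/
def genB (n : ℕ) : KnotGroup n := genY n 0

/-- The element `x`: the `n`-th power of the loop `y₂ y₁⁻¹` around the two parallel strands of the
third column. (The knot `K_n` arises by surgery on an unknot around the third column of
`P(-2, 3, 1)`; the loop is the longitude of the unknot and `x` is its meridian.) Together, `a`, `b`
and `x` generate `G(K_n)`, see `knotGroup_presentation`. -/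
def genX (n : ℕ) : KnotGroup n := (genY n 2 * (genY n 1)⁻¹) ^ n

theorem halfTwist_zpow_map {G H : Type*} [Group G] [Group H] (f : G →* H) (z : ℤ) (q : G × G) :
    Prod.map f f ((halfTwist G ^ z) q) = (halfTwist H ^ z) (Prod.map f f q) := by
  have h1 : ∀ q : G × G, Prod.map f f (halfTwist G q) = halfTwist H (Prod.map f f q) := fun q => by
    simp [halfTwist]
  have h2 : ∀ q : G × G,
      Prod.map f f ((halfTwist G)⁻¹ q) = (halfTwist H)⁻¹ (Prod.map f f q) := fun q => by
    rw [Equiv.Perm.eq_inv_iff_eq, ← h1]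
    simp
  induction z using Int.induction_on generalizing q with
  | zero => simp
  | succ i ih => rw [zpow_add_one, zpow_add_one, Equiv.Perm.mul_apply, ih, h1,
      Equiv.Perm.mul_apply]
  | pred i ih => rw [zpow_sub_one, zpow_sub_one, Equiv.Perm.mul_apply, ih, h2,
      Equiv.Perm.mul_apply]

theorem halfTwist_neg_two {G : Type*} [Group G] (l r : G) :
    (halfTwist G ^ (-2 : ℤ)) (l, r) = (r⁻¹ * l * r, r⁻¹ * l⁻¹ * r * l * r) := by
  rw [show (-2 : ℤ) = -1 + -1 from rfl, zpow_add, zpow_neg_one, Equiv.Perm.mul_apply]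
  have h : ∀ q : G × G, (halfTwist G)⁻¹ q = (q.2, q.2⁻¹ * q.1 * q.2) := fun q => rfl
  simp [h, mul_assoc]

theorem halfTwist_two_mul_add_one {G : Type*} [Group G] (n : ℕ) (l r : G) :
    (halfTwist G ^ (2 * n + 1 : ℤ)) (l, r) =
      ((l * r) ^ n * (l * r * l⁻¹) * ((l * r) ^ n)⁻¹, (l * r) ^ n * l * ((l * r) ^ n)⁻¹) := by
  induction n with
  | zero => simp [halfTwist]
  | succ n ih =>
    rw [show (2 * ((n + 1 : ℕ) : ℤ) + 1) = 1 + (1 + (2 * n + 1)) by push_cast; ring, zpow_add,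
      zpow_add, Equiv.Perm.mul_apply, Equiv.Perm.mul_apply, ih, zpow_one]
    have hc : ∀ g : G, (l * r) ^ (n + 1) * g * ((l * r) ^ (n + 1))⁻¹ =
        (l * r) ^ n * ((l * r) * g * (l * r)⁻¹) * ((l * r) ^ n)⁻¹ := fun g => by
      rw [pow_succ]; group
    rw [hc, hc]
    simp only [halfTwist, Equiv.coe_fn_mk]
    generalize (l * r) ^ n = u
    ext <;> simp only <;> group

/-- The value of the relations of `K_n` under a homomorphism, with `w = a v` and `v = y₁⁻¹`. -/
theorem lift_knotRelators {H : Type*} [Group H] (n : ℕ) (a b v : H) :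
    (FreeGroup.lift ![b, v⁻¹, a] (knotRelators n 0) = 1 ↔ a * v * b * v = b * (a * v) * b) ∧
    (FreeGroup.lift ![b, v⁻¹, a] (pretzelRel (knotTwists n) 2) = 1 ↔
      v = (a * v) ^ n * b * a * ((a * v) ^ n * b)⁻¹) := by
  have e : ∀ (z : ℤ) (q : FreeGroup (Fin 3) × FreeGroup (Fin 3)), _ := fun z q =>
    halfTwist_zpow_map (FreeGroup.lift ![b, v⁻¹, a]) z q
  have e1 : ∀ (z : ℤ) (q : FreeGroup (Fin 3) × FreeGroup (Fin 3)), _ := fun z q =>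
    congrArg Prod.fst (e z q)
  have e2 : ∀ (z : ℤ) (q : FreeGroup (Fin 3) × FreeGroup (Fin 3)), _ := fun z q =>
    congrArg Prod.snd (e z q)
  simp only [Prod.map_fst, Prod.map_snd] at e1 e2
  have t3 : (3 : ℤ) = 2 * (1 : ℕ) + 1 := by norm_num
  constructor
  · simp only [knotRelators, pretzelRelators, pretzelRel, pretzelBottom, knotTwists,
      Matrix.cons_val_zero, map_mul, e1, e2]
    simp only [Matrix.cons_val_zero, zero_add, Matrix.cons_val_one, t3, halfTwist_neg_two,
      halfTwist_two_mul_add_one, Prod.map_apply, map_inv, FreeGroup.lift_apply_of,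
      show (0 : Fin 3) - 1 = 2 from rfl, show (1 : Fin 3) - 1 = 0 from rfl, Matrix.cons_val]
    have key : ∀ W : H, W = b * a⁻¹ * b⁻¹ * ((a * v * b * v) * (b * (a * v) * b)⁻¹) *
        (b * a⁻¹ * b⁻¹)⁻¹ → (W = 1 ↔ a * v * b * v = b * (a * v) * b) := by
      rintro W rfl
      rw [conj_eq_one_iff, mul_inv_eq_one]
    apply key
    simp only [pow_one]
    group
  · simp only [pretzelRel, pretzelBottom, knotTwists, map_mul, e1, e2]
    simp only [Matrix.cons_val_zero, Matrix.cons_val, halfTwist_neg_two,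
      halfTwist_two_mul_add_one, Prod.map_apply, map_inv, FreeGroup.lift_apply_of,
      show (2 : Fin 3) + 1 = 0 from rfl, show (0 : Fin 3) - 1 = 2 from rfl,
      show (2 : Fin 3) - 1 = 1 from rfl]
    have key : ∀ W u : H, W = u⁻¹ * v⁻¹ * u * b * a * b⁻¹ →
        (W = 1 ↔ v = u * b * a * (u * b)⁻¹) := by
      rintro W u rfl
      rw [← inv_inj (a := v), show u⁻¹ * v⁻¹ * u * b * a * b⁻¹ =
        u⁻¹ * (v⁻¹ * (u * b * a * (u * b)⁻¹)) * u⁻¹⁻¹ by group, conj_eq_one_iff,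
        mul_eq_one_iff_eq_inv]
    apply key _ ((a * v) ^ n)
    have hw : (v⁻¹ * a⁻¹) ^ n = ((a * v) ^ n)⁻¹ := by rw [← inv_pow, mul_inv_rev]
    rw [hw]
    group

/-- The relators `x b w⁻¹ (a x b)⁻¹ x b (w⁻¹ x)⁻¹` and `w ^ n x⁻¹`, `w = a x b a (x b)⁻¹`, in the
free group on `a, b, x`. -/
def abxRelators (n : ℕ) : Fin 2 → FreeGroup (Fin 3) :=
  let a := FreeGroup.of (0 : Fin 3)
  let b := FreeGroup.of (1 : Fin 3)
  let x := FreeGroup.of (2 : Fin 3)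
  let w := a * x * b * a * (x * b)⁻¹
  ![x * b * w⁻¹ * (a * x * b)⁻¹ * x * b * (w⁻¹ * x)⁻¹, w ^ n * x⁻¹]

theorem abx_iff {H : Type*} [Group H] (n : ℕ) (a b x v : H) (hx : x = (a * v) ^ n)
    (hv : v = x * b * a * (x * b)⁻¹) :
    a * v * b * v = b * (a * v) * b ↔
      x * b * (a * v)⁻¹ * (a * x * b)⁻¹ * x * b * ((a * v)⁻¹ * x)⁻¹ = 1 := by
  have hc : a * v * x = x * (a * v) := by
    rw [hx]; exact ((Commute.refl (a * v)).pow_right n).eq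
  have h1 : a * v * (x * b) * v = a * (x * b) * (a * v) := by
    rw [hv]; group
  have h2 : (a * v)⁻¹ * (x * b)⁻¹ * a⁻¹ = v⁻¹ * (x * b)⁻¹ * (a * v)⁻¹ := by
    have := congrArg (fun g => g⁻¹) h1
    simpa [mul_assoc] using this.symm
  have h3 : x⁻¹ * (a * v) = a * v * x⁻¹ := by
    rw [inv_mul_eq_iff_eq_mul, ← mul_assoc, ← hc, mul_inv_cancel_right]
  have h4 : x⁻¹ * (a * v)⁻¹ * x = (a * v)⁻¹ := by
    rw [mul_assoc, inv_mul_eq_iff_eq_mul, inv_mul_eq_iff_eq_mul, ← mul_assoc, hc,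
      mul_inv_cancel_right]
  have h5 : x * b * (a * v)⁻¹ * (a * x * b)⁻¹ * x * b * ((a * v)⁻¹ * x)⁻¹ =
      x * ((a * v * b * v * b⁻¹)⁻¹ * (b * (a * v))) * x⁻¹ := by
    calc x * b * (a * v)⁻¹ * (a * x * b)⁻¹ * x * b * ((a * v)⁻¹ * x)⁻¹
        = x * b * ((a * v)⁻¹ * (x * b)⁻¹ * a⁻¹) * x * b * (x⁻¹ * (a * v)) := by group
      _ = x * b * (v⁻¹ * b⁻¹ * (x⁻¹ * (a * v)⁻¹ * x)) * b * (a * v * x⁻¹) := by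
        rw [h2, h3]; group
      _ = x * ((a * v * b * v * b⁻¹)⁻¹ * (b * (a * v))) * x⁻¹ := by rw [h4]; group
  rw [h5, conj_eq_one_iff, inv_mul_eq_one, mul_inv_eq_iff_eq_mul]

theorem mk_eq_lift (n : ℕ) (g : FreeGroup (Fin 3)) :
    PresentedGroup.mk (Set.range (knotRelators n)) g =
      FreeGroup.lift ![genB n, (genY n 1)⁻¹⁻¹, genA n] g := by
  refine DFunLike.congr_fun (f := PresentedGroup.mk (Set.range (knotRelators n))) ?_ g
  ext i
  fin_cases i <;> simp [genB, genA, genY, PresentedGroup.of]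

/-- The elements `a, b, x` generate the knot group of `K_n`, with defining relations
`w⁻¹ x = x b w⁻¹ (a x b)⁻¹ x b` and `x = w ^ n`, where `w = a x b a (x b)⁻¹`. -/
theorem knotGroup_presentation (n : ℕ) :
    ∃ e : Group1 (abxRelators n) ≃* KnotGroup n,
      e (PresentedGroup.of 0) = genA n ∧ e (PresentedGroup.of 1) = genB n ∧
        e (PresentedGroup.of 2) = genX n := by
  have k0 := (lift_knotRelators n (genA n) (genB n) (genY n 1)⁻¹).1.1 (by
    rw [← mk_eq_lift]; exact PresentedGroup.one_of_mem ⟨0, rfl⟩)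
  have k2 := (lift_knotRelators n (genA n) (genB n) (genY n 1)⁻¹).2.1 (by
    rw [← mk_eq_lift]; exact pretzelRel_two _)
  have hx : genX n = (genA n * (genY n 1)⁻¹) ^ n := rfl
  rw [← hx] at k2
  have kw : genA n * genX n * genB n * genA n * (genX n * genB n)⁻¹ =
      genA n * (genY n 1)⁻¹ := by
    conv_rhs => rw [k2]
    group
  have hf : ∀ r ∈ Set.range (abxRelators n),
      FreeGroup.lift ![genA n, genB n, genX n] r = 1 := by
    rintro _ ⟨i, rfl⟩
    fin_cases i
    · have := (abx_iff n _ _ _ _ hx k2).1 k0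
      simpa [abxRelators, -mul_inv_rev, kw] using this
    · simpa [abxRelators, -mul_inv_rev, kw] using mul_inv_eq_one.2 hx.symm
  let a : Group1 (abxRelators n) := PresentedGroup.of 0
  let b : Group1 (abxRelators n) := PresentedGroup.of 1
  let x : Group1 (abxRelators n) := PresentedGroup.of 2
  let v := x * b * a * (x * b)⁻¹
  have q0 : x * b * (a * v)⁻¹ * (a * x * b)⁻¹ * x * b * ((a * v)⁻¹ * x)⁻¹ = 1 := by
    have : PresentedGroup.mk (Set.range (abxRelators n)) (abxRelators n 0) = 1 :=
      PresentedGroup.one_of_mem ⟨0, rfl⟩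
    have hv : a * v = a * x * b * a * (x * b)⁻¹ := by simp only [v, mul_assoc]
    rw [hv]
    exact this
  have q1 : x = (a * v) ^ n := by
    have : PresentedGroup.mk (Set.range (abxRelators n)) (abxRelators n 1) = 1 :=
      PresentedGroup.one_of_mem ⟨1, rfl⟩
    have hv : a * v = a * x * b * a * (x * b)⁻¹ := by simp only [v, mul_assoc]
    rw [hv]
    refine (mul_inv_eq_one.1 ?_).symm
    exact this
  have r0 := (lift_knotRelators n a b v).1.2 ((abx_iff n a b x v q1 rfl).2 q0)
  have r2 := (lift_knotRelators n a b v).2.2 (by rw [← q1])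
  have hg : ∀ r ∈ Set.range (knotRelators n), FreeGroup.lift ![b, v⁻¹, a] r = 1 := by
    rintro _ ⟨i, rfl⟩
    fin_cases i
    · exact r0
    · rw [pretzelRel_prod, map_inv, map_mul, inv_eq_one] at r2
      have r0' : FreeGroup.lift ![b, v⁻¹, a] (pretzelRel (knotTwists n) 0) = 1 := r0
      rw [r0', one_mul] at r2
      exact r2
  let f := PresentedGroup.toGroup hf
  let g := PresentedGroup.toGroup hg
  have fa : f a = genA n := by simp [f, a]
  have fb : f b = genB n := by simp [f, b]
  have fx : f x = genX n := by simp [f, x]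
  have ga : g (genA n) = a := by simp [g, genA, genY]
  have gb : g (genB n) = b := by simp [g, genB, genY]
  have gv : g (genY n 1) = v⁻¹ := by simp [g, genY]
  refine ⟨MonoidHom.toMulEquiv f g ?_ ?_, fa, fb, fx⟩
  · ext i
    fin_cases i
    · exact (congrArg g fa).trans ga
    · exact (congrArg g fb).trans gb
    · refine (congrArg g fx).trans ?_
      rw [hx, map_pow, map_mul, map_inv, ga, gv, inv_inv, ← q1]
      rfl
  · ext i
    fin_cases i
    · exact (congrArg f gb).trans fb
    · refine (congrArg f gv).trans ?_
      have : f v⁻¹ = (genY n 1)⁻¹⁻¹ := by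
        rw [k2]
        simp only [v, map_inv, map_mul, fa, fb, fx]
      rw [this, inv_inv]
      rfl
    · exact (congrArg f ga).trans fa

/-- The abelianization `α : G(K_n) → ⟨t⟩`, sending the meridians `a` and `b` to `t`. -/
def abel (n : ℕ) : KnotGroup n →* Multiplicative ℤ :=
  PresentedGroup.toGroup
    (f := ![Multiplicative.ofAdd 1, (Multiplicative.ofAdd 1)⁻¹, Multiplicative.ofAdd 1]) (by
    have h := lift_knotRelators n (Multiplicative.ofAdd (1 : ℤ)) (Multiplicative.ofAdd 1)
      (Multiplicative.ofAdd 1)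
    have r0 := h.1.2 (by simp [mul_comm])
    have r2 := h.2.2 (by rw [mul_assoc, mul_comm (_ ^ n), mul_inv_rev]; simp)
    rintro _ ⟨i, rfl⟩
    fin_cases i
    · exact r0
    · rw [pretzelRel_prod, map_inv, map_mul, inv_eq_one] at r2
      have r0' := r0
      rw [show knotRelators n 0 = pretzelRel (knotTwists n) 0 from rfl] at r0'
      rw [r0', one_mul] at r2
      exact r2)

theorem abel_genA (n : ℕ) : abel n (genA n) = Multiplicative.ofAdd 1 := by
  simp [abel, genA, genY]

theorem abel_genB (n : ℕ) : abel n (genB n) = Multiplicative.ofAdd 1 := by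
  simp [abel, genB, genY]

/-! ### The representation `ρ_m` and the coefficients -/

section Formulas

variable (n : ℕ) (m s : ℂ)

/-- The polynomial `r₀` of which `s` is a root. -/
def rZero : ℂ :=
  m ^ 8 * ((s - 1) * (s + 1) ^ 2 * (s ^ (2 * n) - s ^ 2) * s ^ (2 * n + 2))
  - m ^ 6 * (s ^ (6 * n + 3)
      + (2 * s ^ 6 + s ^ 5 - 4 * s ^ 4 + s ^ 3 + s ^ 2 - s - 1) * s ^ (4 * n + 1)
      - (s ^ 6 + s ^ 5 - s ^ 4 - s ^ 3 + 4 * s ^ 2 - s - 2) * s ^ (2 * n + 2) + s ^ 6)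
  + m ^ 4 * ((s ^ 2 + 1) * s ^ (6 * n + 2)
      + (s ^ 6 + 2 * s ^ 5 - 3 * s ^ 4 - 2 * s ^ 3 + 6 * s ^ 2 - 4 * s - 2) * s ^ (4 * n + 3)
      - (2 * s ^ 6 + 4 * s ^ 5 - 6 * s ^ 4 + 2 * s ^ 3 + 3 * s ^ 2 - 2 * s - 1) * s ^ (2 * n)
      + (s ^ 2 + 1) * s ^ 5)
  - m ^ 2 * (s ^ (6 * n + 3)
      + (2 * s ^ 6 + s ^ 5 - 4 * s ^ 4 + s ^ 3 + s ^ 2 - s - 1) * s ^ (4 * n + 1)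
      - (s ^ 6 + s ^ 5 - s ^ 4 - s ^ 3 + 4 * s ^ 2 - s - 2) * s ^ (2 * n + 2) + s ^ 6)
  + (s - 1) * (s + 1) ^ 2 * (s ^ (2 * n) - s ^ 2) * s ^ (2 * n + 2)

def alpha : ℂ :=
  (s ^ 2 - 1) * s ^ (2 * n) *
    (-m ^ 6 * (s - 1) * s ^ 2 * (s ^ (2 * n + 1) + 1)
      + m ^ 4 * (s ^ (2 * n + 2) * (s ^ 4 - 2 * s ^ 2 + 3 * s - 1)
          + s ^ 4 - 3 * s ^ 3 + 2 * s ^ 2 - 1)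
      - m ^ 2 * s * (s ^ (2 * n) * (2 * s ^ 3 - s ^ 2 + 1) - s * (s ^ 3 - s + 2))
      + s ^ 2 * (s ^ (2 * n) - s ^ 2))

/-- For `n ≥ 1`, so that the exponent `2 * n - 2` is not truncated. -/
def beta : ℂ :=
  m ^ 7 * s ^ (2 * n + 2) * (s ^ 2 - 1) * (s ^ 3 + 1)
  - m ^ 5 * s ^ 3 * (s ^ (4 * n) * (s ^ 3 - s ^ 2 + 1)
      + s ^ (2 * n - 2) * (s - 1) * (s ^ 3 + s + 1) * (s ^ 3 + s ^ 2 + 1) - (s ^ 3 - s + 1))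
  + m ^ 3 * s ^ 2 * (s ^ 3 + 1) * (s ^ (2 * n) - 1) * (s ^ (2 * n) + s ^ 2)
  - m * s ^ 3 * (s ^ (2 * n) - s ^ 2) * (s ^ (2 * n) + s)

noncomputable def matA : Matrix (Fin 2) (Fin 2) ℂ :=
  !![m, -((m ^ 2 - s) * (s ^ (2 * n + 1) + 1) / (m * (s + 1)));
     0, m⁻¹]

noncomputable def matB : Matrix (Fin 2) (Fin 2) ℂ :=
  (1 / (s * alpha n m s)) •
    !![beta n m s,
       -((s * alpha n m s - m * beta n m s) * (m * s * alpha n m s - beta n m s)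
          / (m * beta n m s));
       beta n m s,
       (m * (m * s * alpha n m s - beta n m s) + s * alpha n m s) / m]

noncomputable def matX : Matrix (Fin 2) (Fin 2) ℂ :=
  !![s ^ n, 0;
     (s ^ n - (s ^ n)⁻¹) / (s ^ (2 * n + 1) + 1), (s ^ n)⁻¹]

/-- `ρ` is the representation `ρ_m` (for the root `s` of `r₀`). -/
def IsRhoM (ρ : KnotGroup n →* Matrix.SpecialLinearGroup (Fin 2) ℂ) : Prop :=
  (ρ (genA n) : Matrix (Fin 2) (Fin 2) ℂ) = matA n m s ∧
  (ρ (genB n) : Matrix (Fin 2) (Fin 2) ℂ) = matB n m s ∧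
  (ρ (genX n) : Matrix (Fin 2) (Fin 2) ℂ) = matX n s

def bigH : ℂ := 1 - m ^ 2 * s + m ^ 2 * s ^ (2 * n + 1) - s ^ (2 * n + 2)

def etaOne : ℂ :=
  m * alpha n m s - m * s ^ (2 * n + 1) * alpha n m s + s ^ (2 * n) * beta n m s
    + m ^ 2 * s ^ (2 * n) * beta n m s

def etaTwo : ℂ :=
  -(m * s * alpha n m s) + m * s ^ (2 * n + 1) * alpha n m s - s ^ (2 * n) * beta n m s
    - s ^ (2 * n + 1) * beta n m s

/-- The coefficient `λ_i`, for `0 ≤ i ≤ 2n - 1`. -/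
noncomputable def coeffLambda (i : ℕ) : ℂ :=
  if i + 1 = 2 * n then
    (s ^ (n - 1) - (s ^ (n - 1))⁻¹) / (s - s⁻¹)
      - (s ^ 2 - 1) * etaOne n m s / (bigH n m s * s ^ n * beta n m s)
  else if Even i then
    (1 + m ^ 2) * (bigH n m s * s ^ (i / 2 + 1) * beta n m s
        - s * (s ^ (i / 2 + 1) - (s ^ (i / 2 + 1))⁻¹) * (etaOne n m s + etaTwo n m s))
      / (bigH n m s * m * beta n m s)
  else
    (s ^ ((i - 1) / 2) - (s ^ ((i - 1) / 2))⁻¹) / (s - s⁻¹)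

open Polynomial in
/-- The polynomial `1 + ∑_{i=0}^{2n-1} λ_i (t^{i+3} + t^{4n-i+3}) + t^{4n+6}`. -/
noncomputable def alexPoly : ℂ[X] :=
  1 + ∑ i ∈ Finset.range (2 * n), C (coeffLambda n m s i) * (X ^ (i + 3) + X ^ (4 * n - i + 3))
    + X ^ (4 * n + 6)

end Formulas

end PretzelTAP

/-!
Put `u = s ^ (2 n)`, `p = β / (s α)`, `v = y₁⁻¹` and `w = a v`, so that `x = w ^ n`. The relations
of the knot group are `w b v = b w b` and `v (x b) = (x b) a`.

*The representation.* The matrices of `a`, `v`, `w`, `x` depend on `m`, `s`, `u` (and `s ^ n`) only,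
and the matrix of `b` depends on `m` and `p`. The second relation reduces to one quadratic equation
`conjRel` for `p`. That `s` is a root of `r₀` implies this equation and two linear equations
`linRel`, `linRel'` for `p` (`IsParam.of_root`). Because `m`, `s`, `u`, `H` are invertible, the
first relation is a consequence: both sides have the form `G V` and `B G` with `V` and `B` of the
same trace, so that it suffices to compare one column (`mul_eq_mul_of_col`), and the two remaining
entries lie in the ideal generated by the three equations (`IsParam.braid_zero_zero`,
`IsParam.braid_one_zero`). Uniqueness holds because `a`, `b`, `x` generate the group.

*Wada's invariant.* By the fundamental formula of Fox calculus the quotient does not depend on the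
deleted column (`det_wadaMatrix_mul_wadaDenom`), so that the column of `y₁` may be deleted, and the
second relator may be replaced by the relation of the third arc. With the two relations above, the
Fox matrix consists of four blocks of size two, in which `n` enters through `t ^ (2 n)`, `x`, and
the geometric sum of the powers of `t² w` (`det_wadaMatrix_one`). Multiplication by
`det (t² w - 1) = t⁴ - (s + s⁻¹) t² + 1` removes the geometric sum, and the remaining determinant of
size two is a quadratic polynomial in `t ^ (2 n)`. The relations imply that it is divisible by the
characteristic polynomial `t² - (m + m⁻¹) t + 1` of the meridians, which is the denominator up to a
power of `t`, and that the quotient depends only on the traces of `a`, `w`, `b w`, `x b`, `x b v`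
and `w⁻¹ x` (`KnotMatrices.det_blocks`).

*The coefficients.* The `λ_i` with `i` of a given parity are combinations of powers of `s` and of
`s⁻¹`, up to an additional term for `i = 2n - 1`. Multiplied by `t⁴ - (s + s⁻¹) t² + 1`, the
polynomial with these coefficients telescopes (`quadratic_mul_palindromic`), again to a quadratic
polynomial in `t ^ (2 n)`. The coefficients agree by the explicit values of the traces and by three
further identities that follow from the equations for `p` (`IsParam.coefficient_identities`).
-/

namespace PretzelTAP

/-! ### Fox derivatives under a representation -/

section Fox

variable {k d : ℕ} {F : Type*} [Field F] (r : Fin k → FreeGroup (Fin (k + 1)))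
  (ρ : Group1 r →* GL (Fin d) F) (α : Group1 r →* Multiplicative ℤ)

/-- The restriction of `Φ` to the free group. -/
noncomputable def wadaGroup :
    FreeGroup (Fin (k + 1)) →* Matrix (Fin d) (Fin d) F[T;T⁻¹] :=
  (twist ρ α).comp (PresentedGroup.mk (Set.range r))

/-- The image under `Φ` of the Fox derivative `∂g/∂x_j`. -/
noncomputable def wadaFox (j : Fin (k + 1)) (g : FreeGroup (Fin (k + 1))) :
    Matrix (Fin d) (Fin d) F[T;T⁻¹] :=
  wadaPhi r ρ α (foxDeriv j g)

theorem wadaPhi_of (g : FreeGroup (Fin (k + 1))) :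
    wadaPhi r ρ α (MonoidAlgebra.of ℤ _ g) = wadaGroup r ρ α g := by
  simp [wadaPhi, wadaGroup]

theorem wadaGroup_relator (i : Fin k) : wadaGroup r ρ α (r i) = 1 := by
  have : PresentedGroup.mk (Set.range r) (r i) = 1 := PresentedGroup.one_of_mem ⟨i, rfl⟩
  simp [wadaGroup, this]

theorem wadaGroup_mul_inv (g : FreeGroup (Fin (k + 1))) :
    wadaGroup r ρ α g * wadaGroup r ρ α g⁻¹ = 1 := by
  rw [← map_mul, mul_inv_cancel, map_one]

theorem wadaFox_of (i j : Fin (k + 1)) :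
    wadaFox r ρ α j (FreeGroup.of i) = if i = j then 1 else 0 := by
  rw [wadaFox, foxDeriv_of]
  split_ifs <;> simp

theorem wadaFox_mul (j : Fin (k + 1)) (g h : FreeGroup (Fin (k + 1))) :
    wadaFox r ρ α j (g * h) = wadaFox r ρ α j g + wadaGroup r ρ α g * wadaFox r ρ α j h := by
  rw [wadaFox, foxDeriv_mul, map_add, map_mul, wadaPhi_of]
  rfl

theorem wadaFox_one (j : Fin (k + 1)) : wadaFox r ρ α j 1 = 0 := by
  simpa using wadaFox_mul r ρ α j 1 1

theorem wadaFox_inv (j : Fin (k + 1)) (g : FreeGroup (Fin (k + 1))) :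
    wadaFox r ρ α j g⁻¹ = -(wadaGroup r ρ α g⁻¹ * wadaFox r ρ α j g) := by
  have h := wadaFox_mul r ρ α j g⁻¹ g
  rw [inv_mul_cancel, wadaFox_one] at h
  exact eq_neg_of_add_eq_zero_left h.symm

theorem wadaFox_pow (j : Fin (k + 1)) (g : FreeGroup (Fin (k + 1))) (n : ℕ) :
    wadaFox r ρ α j (g ^ n) =
      (∑ i ∈ Finset.range n, wadaGroup r ρ α g ^ i) * wadaFox r ρ α j g := by
  induction n with
  | zero => simp [wadaFox_one]
  | succ n ih => rw [pow_succ, wadaFox_mul, ih, Finset.sum_range_succ, add_mul, map_pow]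

/-- If `P Q⁻¹` is a relation, then the Fox derivatives of its conjugate `c P Q⁻¹ c⁻¹` differ from
those of `P` minus those of `Q` by the factor `Φ(c)` only. -/
theorem wadaFox_conj (j : Fin (k + 1)) (c P Q : FreeGroup (Fin (k + 1)))
    (h : wadaGroup r ρ α (c * (P * Q⁻¹) * c⁻¹) = 1) :
    wadaFox r ρ α j (c * (P * Q⁻¹) * c⁻¹) =
      wadaGroup r ρ α c * (wadaFox r ρ α j P - wadaFox r ρ α j Q) := by
  have hPQ : wadaGroup r ρ α P * wadaGroup r ρ α Q⁻¹ = 1 := by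
    have : P * Q⁻¹ = c⁻¹ * (c * (P * Q⁻¹) * c⁻¹) * c := by group
    rw [← map_mul, this, map_mul, map_mul, h, mul_one, ← map_mul, inv_mul_cancel, map_one]
  have e : wadaFox r ρ α j (c * (P * Q⁻¹) * c⁻¹) + wadaFox r ρ α j c =
      wadaFox r ρ α j (c * (P * Q⁻¹)) := by
    rw [← one_mul (wadaFox r ρ α j c), ← h, ← wadaFox_mul, inv_mul_cancel_right]
  rw [wadaFox_mul _ _ _ _ c, wadaFox_mul _ _ _ _ P, wadaFox_inv, mul_neg,
    ← mul_assoc (wadaGroup r ρ α P), hPQ, one_mul,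
    ← sub_eq_add_neg, add_comm] at e
  exact add_left_cancel e

/-- The fundamental formula of Fox calculus, under `Φ`. -/
theorem sum_wadaFox_mul (g : FreeGroup (Fin (k + 1))) :
    ∑ j, wadaFox r ρ α j g * (wadaGroup r ρ α (FreeGroup.of j) - 1) = wadaGroup r ρ α g - 1 := by
  induction g using FreeGroup.induction_on with
  | C1 => simp [wadaFox_one]
  | of i => simp [wadaFox_of]
  | inv_of i ih =>
    simp only [wadaFox_inv, neg_mul, Finset.sum_neg_distrib, mul_assoc]
    rw [← Finset.mul_sum, ih, mul_sub, mul_one, ← map_mul, inv_mul_cancel, map_one, neg_sub]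
  | mul x y hx hy =>
    simp only [wadaFox_mul, add_mul, Finset.sum_add_distrib, mul_assoc]
    rw [← Finset.mul_sum, hx, hy, mul_sub, mul_one, map_mul]
    abel

theorem wadaDenom_eq (j : Fin (k + 1)) :
    wadaDenom r ρ α j = (wadaGroup r ρ α (FreeGroup.of j) - 1).det := by
  rw [wadaDenom, map_sub, wadaPhi_of, map_one]

end Fox

/-! ### Determinants of block matrices -/

section Blocks

variable {R ι : Type*} [CommRing R] [Fintype ι] [DecidableEq ι]

/-- Two block rows and three block columns killed by a column of blocks `E`: deleting the first or
the second block column gives proportional determinants (for blocks of even size, without sign). -/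
theorem det_fromBlocks_mul_det_eq (hι : Even (Fintype.card ι))
    (P₀ P₁ P₂ Q₀ Q₁ Q₂ E₀ E₁ E₂ : Matrix ι ι R)
    (hP : P₀ * E₀ + P₁ * E₁ + P₂ * E₂ = 0) (hQ : Q₀ * E₀ + Q₁ * E₁ + Q₂ * E₂ = 0) :
    (Matrix.fromBlocks P₁ P₂ Q₁ Q₂).det * E₁.det =
      (Matrix.fromBlocks P₀ P₂ Q₀ Q₂).det * E₀.det := by
  have h : Matrix.fromBlocks P₁ P₂ Q₁ Q₂ * Matrix.fromBlocks (-E₁) 0 (-E₂) 1 =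
      Matrix.fromBlocks P₀ P₂ Q₀ Q₂ * Matrix.fromBlocks E₀ 0 0 1 := by
    rw [Matrix.fromBlocks_multiply, Matrix.fromBlocks_multiply]
    congr 1
    · rw [mul_zero, add_zero, ← sub_eq_zero, ← neg_eq_zero, ← hP]; noncomm_ring
    · simp
    · rw [mul_zero, add_zero, ← sub_eq_zero, ← neg_eq_zero, ← hQ]; noncomm_ring
    · simp
  have h2 := congrArg Matrix.det h
  rw [Matrix.det_mul, Matrix.det_mul, Matrix.det_fromBlocks_zero₁₂, Matrix.det_fromBlocks_zero₁₂,
    Matrix.det_neg, hι.neg_one_pow, Matrix.det_one, one_mul, mul_one, mul_one] at h2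
  exact h2

theorem det_fromBlocks_swap_cols (hι : Even (Fintype.card ι)) (P₀ P₁ Q₀ Q₁ : Matrix ι ι R) :
    (Matrix.fromBlocks P₀ P₁ Q₀ Q₁).det = (Matrix.fromBlocks P₁ P₀ Q₁ Q₀).det := by
  have h : (Matrix.fromBlocks P₀ P₁ Q₀ Q₁) * Matrix.fromBlocks 1 0 1 1 *
      Matrix.fromBlocks 1 (-1) 0 1 * Matrix.fromBlocks 1 0 1 1 * Matrix.fromBlocks 1 0 0 (-1) =
      Matrix.fromBlocks P₁ P₀ Q₁ Q₀ := by
    simp only [Matrix.fromBlocks_multiply]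
    congr 1 <;> simp
  have h2 := congrArg Matrix.det h
  simpa [Matrix.det_mul, Matrix.det_neg, hι.neg_one_pow] using h2

/-- The block rows `c P` and `-c P + d Q` are combinations of the block rows `P` and `Q`. -/
theorem det_fromBlocks_of_rows {F₀ F₁ G₀ G₁ H₀ H₁ c d P₀ P₁ Q₀ Q₁ : Matrix ι ι R}
    (hF₀ : F₀ = c * P₀) (hF₁ : F₁ = c * P₁)
    (hG₀ : G₀ = d * -Q₀) (hG₁ : G₁ = d * -Q₁) (hH₀ : H₀ = -F₀ - G₀) (hH₁ : H₁ = -F₁ - G₁) :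
    (Matrix.fromBlocks F₀ F₁ H₀ H₁).det = c.det * d.det * (Matrix.fromBlocks P₀ P₁ Q₀ Q₁).det := by
  have e : Matrix.fromBlocks F₀ F₁ H₀ H₁ =
      Matrix.fromBlocks c 0 (-c) d * Matrix.fromBlocks P₀ P₁ Q₀ Q₁ := by
    rw [Matrix.fromBlocks_multiply, hH₀, hH₁, hG₀, hG₁, hF₀, hF₁]
    simp only [zero_mul, add_zero, mul_neg, neg_mul, sub_neg_eq_add]
  rw [e, Matrix.det_mul, Matrix.det_fromBlocks_zero₁₂]

end Blocks

open Matrix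

/-! ### Trace identities for two-by-two matrices -/

section TraceAlgebra

variable {R : Type*} [CommRing R]

theorem adjugate_eq_trace_smul_sub (M : Matrix (Fin 2) (Fin 2) R) :
    M.adjugate = M.trace • 1 - M := by
  rw [adjugate_fin_two, trace_fin_two]
  ext i j
  fin_cases i <;> fin_cases j <;> simp

theorem trace_adjugate_fin_two (M : Matrix (Fin 2) (Fin 2) R) : M.adjugate.trace = M.trace := by
  rw [adjugate_fin_two, trace_fin_two, trace_fin_two, add_comm]
  rfl

theorem trace_adjugate_mul (M N : Matrix (Fin 2) (Fin 2) R) :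
    (M.adjugate * N).trace = M.trace * N.trace - (M * N).trace := by
  rw [adjugate_eq_trace_smul_sub, sub_mul, smul_mul_assoc, one_mul, trace_sub, trace_smul,
    smul_eq_mul]

theorem trace_mul_self_mul {M : Matrix (Fin 2) (Fin 2) R} (hM : M.det = 1)
    (N : Matrix (Fin 2) (Fin 2) R) :
    (M * (M * N)).trace = M.trace * (M * N).trace - N.trace := by
  have h := trace_adjugate_mul M (M * N)
  rw [← mul_assoc M.adjugate, adjugate_mul, hM, one_smul, one_mul] at h
  linear_combination h

theorem trace_mul_self_eq {M : Matrix (Fin 2) (Fin 2) R} (hM : M.det = 1) :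
    (M * M).trace = M.trace ^ 2 - 2 := by
  have h := trace_mul_self_mul hM 1
  rw [mul_one, trace_one, Fintype.card_fin] at h
  rw [h]; push_cast; ring

/-- Conjugate matrices have the same trace, with the conjugation written without an inverse. -/
theorem trace_eq_of_conj {G V A : Matrix (Fin 2) (Fin 2) R} (hG : G.det = 1)
    (h : V * G = G * A) : V.trace = A.trace := by
  have h1 : V = G * A * G.adjugate := by
    rw [← h, mul_assoc, mul_adjugate, hG, one_smul, mul_one]
  rw [h1, trace_mul_comm, ← mul_assoc, adjugate_mul, hG, one_smul, one_mul]

theorem det_add_fin_two (P Q : Matrix (Fin 2) (Fin 2) R) :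
    (P + Q).det = P.det + (P.adjugate * Q).trace + Q.det := by
  rw [adjugate_fin_two, trace_fin_two]
  simp only [det_fin_two, mul_apply, Fin.sum_univ_two, Matrix.add_apply, of_apply, cons_val',
    cons_val_zero, cons_val_one, cons_val_fin_one]
  ring

theorem adjugate_sub_fin_two (P Q : Matrix (Fin 2) (Fin 2) R) :
    (P - Q).adjugate = P.adjugate - Q.adjugate := by
  simp only [adjugate_eq_trace_smul_sub, trace_sub, sub_smul]
  abel

theorem adjugate_smul_fin_two (c : R) (P : Matrix (Fin 2) (Fin 2) R) :
    (c • P).adjugate = c • P.adjugate := by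
  rw [adjugate_smul, Fintype.card_fin, pow_one]

theorem det_smul_sub_one (t : R) {M : Matrix (Fin 2) (Fin 2) R} (hM : M.det = 1) :
    (t • M - 1).det = t ^ 2 - M.trace * t + 1 := by
  simp only [det_fin_two] at hM
  simp only [det_fin_two, trace_fin_two, Matrix.sub_apply, Matrix.smul_apply, smul_eq_mul]
  simp
  linear_combination t ^ 2 * hM

/-- Matrices satisfying the relations of the images of `a`, `b`, `v = y₁⁻¹`, `w = a v` and
`x = w ^ n` under a representation of `G(K_n)` into `SL₂`. Of the equation `x = w ^ n` only the
consequences `det_X` and `comm` are recorded, so that `n` does not occur. -/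
structure KnotMatrices (A B V W X : Matrix (Fin 2) (Fin 2) R) : Prop where
  det_A : A.det = 1
  det_B : B.det = 1
  det_W : W.det = 1
  det_X : X.det = 1
  trace_B : B.trace = A.trace
  mul_V : A * V = W
  braid : W * B * V = B * W * B
  conj : V * (X * B) = X * B * A
  comm : X * W = W * X

end TraceAlgebra

/-! ### Traces of words in the knot group

In the names of the lemmas, a prime after a letter denotes the adjugate, which is the inverse. -/

namespace KnotMatrices
variable {R : Type*} [CommRing R] {A B V W X : Matrix (Fin 2) (Fin 2) R}

theorem det_V (h : KnotMatrices A B V W X) : V.det = 1 := by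
  have := congrArg det h.mul_V
  rwa [det_mul, h.det_A, h.det_W, one_mul] at this

theorem det_XB (h : KnotMatrices A B V W X) : (X * B).det = 1 := by
  rw [det_mul, h.det_X, h.det_B, one_mul]

theorem trace_V (h : KnotMatrices A B V W X) : V.trace = A.trace :=
  trace_eq_of_conj h.det_XB h.conj

theorem adjugate_A_mul (h : KnotMatrices A B V W X) (M : Matrix (Fin 2) (Fin 2) R) :
    A.adjugate * (W * M) = V * M := by
  rw [← h.mul_V, mul_assoc, ← mul_assoc A.adjugate, adjugate_mul, h.det_A, one_smul, one_mul]

theorem trace_WB (_ : KnotMatrices A B V W X) : (W * B).trace = (B * W).trace :=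
  trace_mul_comm _ _

theorem trace_BWB (h : KnotMatrices A B V W X) :
    (B * W * B).trace = A.trace * (B * W).trace - W.trace := by
  rw [trace_mul_comm, trace_mul_self_mul h.det_B, h.trace_B]

theorem trace_VWB (h : KnotMatrices A B V W X) :
    (V * (W * B)).trace = A.trace * (B * W).trace - W.trace := by
  rw [trace_mul_comm, h.braid, h.trace_BWB]

theorem trace_VB'WB (h : KnotMatrices A B V W X) :
    (V * (B.adjugate * (W * B))).trace = (B * W).trace := by
  rw [trace_mul_comm, mul_assoc, h.braid, mul_assoc B, ← mul_assoc, adjugate_mul, h.det_B, one_smul,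
    one_mul, trace_mul_comm]

theorem trace_WBWB (h : KnotMatrices A B V W X) :
    (W * (B * (W * B))).trace = (B * W).trace ^ 2 - 2 := by
  rw [← mul_assoc, trace_mul_self_eq (by rw [det_mul, h.det_W, h.det_B, one_mul]), h.trace_WB]

theorem trace_VB (h : KnotMatrices A B V W X) :
    (V * B).trace =
      W.trace * (A.trace * (B * W).trace - W.trace) - ((B * W).trace ^ 2 - 2) := by
  have e : B * V = W.adjugate * (B * W * B) := by
    rw [← h.braid, mul_assoc W, ← mul_assoc, adjugate_mul, h.det_W, one_smul, one_mul]
  rw [trace_mul_comm, e, trace_adjugate_mul, h.trace_BWB, mul_assoc B, h.trace_WBWB]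

theorem trace_WWB (h : KnotMatrices A B V W X) :
    (W * (W * B)).trace = W.trace * (B * W).trace - A.trace := by
  rw [trace_mul_self_mul h.det_W, h.trace_WB, h.trace_B]

theorem trace_WB'WB (h : KnotMatrices A B V W X) :
    (W * (B.adjugate * (W * B))).trace =
      A.trace * (W.trace * (B * W).trace - A.trace) - ((B * W).trace ^ 2 - 2) := by
  rw [adjugate_eq_trace_smul_sub, sub_mul, mul_sub, smul_mul_assoc, one_mul, mul_smul_comm,
    trace_sub, trace_smul, h.trace_WWB, h.trace_WBWB, h.trace_B, smul_eq_mul]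

/-- The matrix is conjugate to `A`: move `X` through `A⁻¹ B⁻¹` by `conj` and through `W` by
`comm`. -/
theorem trace_A'B'WB (h : KnotMatrices A B V W X) :
    (A.adjugate * (B.adjugate * (W * B))).trace = A.trace := by
  have e : A.adjugate * (B.adjugate * X.adjugate) = B.adjugate * (X.adjugate * V.adjugate) := by
    have := congrArg adjugate h.conj
    simp only [adjugate_mul_distrib, mul_assoc] at this
    exact this.symm
  have hX : X.adjugate * X = 1 := by rw [adjugate_mul, h.det_X, one_smul]
  have hB : B * B.adjugate = 1 := by rw [mul_adjugate, h.det_B, one_smul]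
  have hX2 : X * X.adjugate = 1 := by rw [mul_adjugate, h.det_X, one_smul]
  have hV : V * V.adjugate = 1 := by rw [mul_adjugate, h.det_V, one_smul]
  calc (A.adjugate * (B.adjugate * (W * B))).trace
      = (A.adjugate * (B.adjugate * X.adjugate) * (X * W * B)).trace := by
        congr 1
        simp only [mul_assoc]
        rw [← mul_assoc X.adjugate, hX, one_mul]
    _ = (B.adjugate * (X.adjugate * V.adjugate * W * X * B)).trace := by
        rw [e, h.comm]; simp only [mul_assoc]
    _ = (X.adjugate * V.adjugate * W * X).trace := by
        rw [trace_mul_comm, mul_assoc, hB, mul_one]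
    _ = (V.adjugate * (A * V)).trace := by
        rw [trace_mul_comm, mul_assoc, ← mul_assoc X, hX2, one_mul, h.mul_V]
    _ = A.trace := by rw [trace_mul_comm, mul_assoc, hV, mul_one]

theorem trace_XBA (h : KnotMatrices A B V W X) : (X * B * A).trace = (X * B * V).trace := by
  rw [← h.conj, trace_mul_comm]

theorem trace_XBW (h : KnotMatrices A B V W X) :
    (X * B * W).trace = A.trace * (X * B * V).trace - (X * B).trace := by
  rw [← h.mul_V, ← mul_assoc, ← h.conj, trace_mul_comm, trace_mul_self_mul h.det_V, h.trace_V,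
    trace_mul_comm V]

end KnotMatrices

/-! ### The determinant of the Fox matrix in terms of traces -/

namespace KnotMatrices
variable {R : Type*} [CommRing R] {A B V W X : Matrix (Fin 2) (Fin 2) R}

/-- The part of the determinant that does not involve `u = t ^ (2 n)`. -/
theorem det_first_block (h : KnotMatrices A B V W X) (t : R) :
    (t ^ 2 • W - 1 - t ^ 3 • (B * W)).det =
      1 - W.trace * t ^ 2 + (B * W).trace * t ^ 3 + t ^ 4 - A.trace * t ^ 5 + t ^ 6 := by
  have e1 : (W.adjugate * (B * W)).trace = A.trace := by
    rw [trace_mul_comm, mul_assoc, mul_adjugate, h.det_W, one_smul, mul_one, h.trace_B]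
  rw [sub_eq_add_neg _ (t ^ 3 • _), det_add_fin_two, det_smul_sub_one _ h.det_W,
    adjugate_sub_fin_two, adjugate_smul_fin_two, adjugate_one, sub_mul, smul_mul_assoc, one_mul,
    mul_neg, mul_smul_comm, det_neg, det_smul, det_mul, h.det_B, h.det_W, trace_sub, trace_smul,
    trace_neg, trace_smul, trace_neg, trace_smul, e1]
  simp only [Fintype.card_fin, smul_eq_mul]
  ring

/-- The determinant of the block matrix of Fox derivatives, multiplied by that of `t² W - 1`. The
hypothesis on `S` says that it is the geometric sum of the powers `(t² W) ^ i`, `i < n`, for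
`X = W ^ n` and `u = t ^ (2 n)`. -/
theorem det_blocks_mul (h : KnotMatrices A B V W X) (t u : R) (S : Matrix (Fin 2) (Fin 2) R)
    (ht : IsUnit t) (hS : S * (t ^ 2 • W - 1) = u • X - 1) :
    (fromBlocks (t ^ 2 • W - 1 - t ^ 3 • (B * W)) (1 - t • B)
        ((t • V - 1) * (u • X)) ((t • V - 1) * S - (t * u) • (X * B))).det *
      (t ^ 4 - W.trace * t ^ 2 + 1) =
    ((t • V - 1) * (B.adjugate * (t ^ 2 • W - 1 - t ^ 3 • (B * W)) * B) +
      (t * u) • (X * B * ((t • A - 1) + (t ^ 2 • W - 1) *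
        (B.adjugate * (t ^ 2 • W - 1 - t ^ 3 • (B * W)) * B)))).det := by
  set K := t ^ 2 • W - 1 with hK
  set a := K - t ^ 3 • (B * W) with ha
  set J := B.adjugate * a * B with hJ
  have hBJ : B * J = a * B := by
    rw [hJ, ← mul_assoc, ← mul_assoc, mul_adjugate, h.det_B, one_smul, one_mul]
  have hdK : K.det = t ^ 4 - W.trace * t ^ 2 + 1 := by
    rw [hK, det_smul_sub_one _ h.det_W]; ring
  -- adding multiples of the first block column to the second one eliminates `S`
  have e1 : fromBlocks a (1 - t • B) ((t • V - 1) * (u • X))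
        ((t • V - 1) * S - (t * u) • (X * B)) * fromBlocks 1 (-1) 0 K =
      fromBlocks a (t • B) ((t • V - 1) * (u • X))
        (-(t • V - 1) - (t * u) • (X * B * K)) := by
    rw [fromBlocks_multiply]
    congr 1
    · simp
    · rw [ha, hK]
      simp only [sub_mul, mul_sub, smul_mul_assoc, mul_smul_comm, one_mul, mul_one, mul_neg,
        smul_sub, smul_smul]
      rw [show t ^ 2 * t = t ^ 3 by ring]
      abel
    · simp
    · have e : ((t • V - 1) * S - (t * u) • (X * B)) * K =
          (t • V - 1) * (u • X - 1) - (t * u) • (X * B * K) := by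
        rw [sub_mul, mul_assoc _ S, hS, smul_mul_assoc]
      rw [e]
      simp only [mul_sub, mul_smul_comm, mul_one, mul_neg]
      abel
  -- and multiples of the second one eliminate the upper left block
  have hY : (t • V - 1) * (X * B) = X * B * (t • A - 1) := by
    simp only [sub_mul, mul_sub, smul_mul_assoc, mul_smul_comm, one_mul, mul_one, h.conj]
  have e2 : fromBlocks a (t • B) ((t • V - 1) * (u • X))
        (-(t • V - 1) - (t * u) • (X * B * K)) * fromBlocks (t • B) 0 (-J) 1 =
      fromBlocks 0 (t • B) ((t • V - 1) * J + (t * u) • (X * B * ((t • A - 1) + K * J)))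
        (-(t • V - 1) - (t * u) • (X * B * K)) := by
    rw [fromBlocks_multiply]
    congr 1
    · rw [smul_mul_assoc, mul_neg, hBJ, mul_smul_comm, smul_neg, add_neg_cancel]
    · simp
    · have : (t • V - 1) * (u • X) * (t • B) = (t * u) • (X * B * (t • A - 1)) := by
        rw [← hY]
        simp only [smul_mul_assoc, mul_smul_comm, mul_assoc, smul_smul]
      rw [this, mul_add (X * B), smul_add, sub_mul, mul_neg, smul_mul_assoc, mul_neg,
        ← mul_assoc (X * B)]
      simp only [neg_mul, smul_neg]
      abel
    · simp
  have hc : Even (Fintype.card (Fin 2)) := ⟨1, rfl⟩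
  have d1 := congrArg det e1
  have d2 := congrArg det e2
  rw [det_mul, det_fromBlocks_zero₂₁, det_one, one_mul, hdK] at d1
  rw [det_mul, det_fromBlocks_zero₁₂, det_one, mul_one, det_fromBlocks_swap_cols hc 0,
    det_fromBlocks_zero₁₂, ← d1, mul_comm] at d2
  have hu : IsUnit (t • B).det := by
    rw [det_smul, h.det_B, mul_one]
    exact ht.pow _
  exact hu.mul_left_cancel d2

/-- The part of the determinant quadratic in `u = t ^ (2 n)`; it is the reciprocal polynomial
of `det_first_block`. -/
theorem det_quadratic_part (h : KnotMatrices A B V W X) (t : R) :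
    ((t • A - 1) + (t ^ 2 • W - 1) *
        (B.adjugate * (t ^ 2 • W - 1 - t ^ 3 • (B * W)) * B)).det =
      (t ^ 2 - A.trace * t + 1) *
        (t ^ 2 - A.trace * t ^ 3 + t ^ 4 + (B * W).trace * t ^ 5 - W.trace * t ^ 6 + t ^ 8) := by
  have hJ : B.adjugate * (t ^ 2 • W - 1 - t ^ 3 • (B * W)) * B =
      t ^ 2 • (B.adjugate * (W * B)) - 1 - t ^ 3 • (W * B) := by
    simp only [mul_sub, sub_mul, mul_smul_comm, smul_mul_assoc, mul_one, mul_assoc]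
    rw [← mul_assoc B.adjugate B, adjugate_mul, h.det_B, one_smul, one_mul]
  rw [det_add_fin_two, det_smul_sub_one _ h.det_A, det_mul, det_smul_sub_one _ h.det_W, det_mul,
    det_mul, det_adjugate, h.det_first_block, h.det_B, hJ, adjugate_sub_fin_two,
    adjugate_smul_fin_two, adjugate_one]
  simp only [mul_sub, sub_mul, mul_smul_comm, smul_mul_assoc, mul_one, one_mul, smul_sub, smul_smul,
    trace_sub, trace_smul, smul_eq_mul, h.adjugate_A_mul, mul_assoc]
  have hAW : A.adjugate * W = V := by simpa using h.adjugate_A_mul 1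
  rw [hAW, h.trace_VB'WB, h.trace_V, h.trace_VWB, h.trace_A'B'WB, trace_adjugate_fin_two,
    h.trace_VB, h.trace_WB'WB, h.trace_WWB, trace_one, h.trace_WB]
  have hB : (B.adjugate * (W * B)).trace = W.trace := by
    rw [trace_mul_comm, mul_assoc, mul_adjugate, h.det_B, one_smul, mul_one]
  rw [hB]
  simp only [Fintype.card_fin]
  push_cast
  ring

/-- The part of the determinant linear in `u = t ^ (2 n)`: the polarization of the determinant of
`P + u Q` is `tr (adj P * Q)`. The summand of `Q` with `t A - 1` contributes `t1`, as
`(t V - 1) X B = X B (t A - 1)`, and the other one contributes `t2`. -/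
theorem trace_linear_part (h : KnotMatrices A B V W X) (t : R) :
    (((t • V - 1) * (B.adjugate * (t ^ 2 • W - 1 - t ^ 3 • (B * W)) * B)).adjugate *
      (X * B * ((t • A - 1) + (t ^ 2 • W - 1) *
        (B.adjugate * (t ^ 2 • W - 1 - t ^ 3 • (B * W)) * B)))).trace =
      (t ^ 2 - A.trace * t + 1) *
        (t ^ 2 * ((W.trace + 1) * (X * B).trace - A.trace * (X * B * V).trace) - (X * B).trace
          - t ^ 3 * (W.adjugate * X).trace
          + (1 - W.trace * t ^ 2 + (B * W).trace * t ^ 3 + t ^ 4 - A.trace * t ^ 5 + t ^ 6) *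
            ((X * B * V).trace * t + (X * B).trace)) := by
  set K := t ^ 2 • W - 1 with hK
  set a := K - t ^ 3 • (B * W) with ha
  set J := B.adjugate * a * B with hJ
  have hdJ : J.det =
      1 - W.trace * t ^ 2 + (B * W).trace * t ^ 3 + t ^ 4 - A.trace * t ^ 5 + t ^ 6 := by
    rw [hJ, det_mul, det_mul, det_adjugate, h.det_B, ha, hK, h.det_first_block]
    simp
  have hB : B.adjugate * B = 1 := by rw [adjugate_mul, h.det_B, one_smul]
  have hB' : B * B.adjugate = 1 := by rw [mul_adjugate, h.det_B, one_smul]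
  have hW : W.adjugate * W = 1 := by rw [adjugate_mul, h.det_W, one_smul]
  have hdV : (t • V - 1).det = t ^ 2 - A.trace * t + 1 := by
    rw [det_smul_sub_one _ h.det_V, h.trace_V]
  have hY : (t • V - 1) * (X * B) = X * B * (t • A - 1) := by
    simp only [sub_mul, mul_sub, smul_mul_assoc, mul_smul_comm, one_mul, mul_one, h.conj]
  have hYV : V.adjugate * (X * B) = X * B * A.adjugate := by
    have hV : V.adjugate * V = 1 := by rw [adjugate_mul, h.det_V, one_smul]
    have hA : A * A.adjugate = 1 := by rw [mul_adjugate, h.det_A, one_smul]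
    calc V.adjugate * (X * B) = V.adjugate * (X * B * A) * A.adjugate := by
          rw [mul_assoc, mul_assoc _ A, hA, mul_one]
      _ = X * B * A.adjugate := by
          rw [← h.conj, ← mul_assoc V.adjugate, hV, one_mul]
  have t1 : (J.adjugate * (X * B)).trace =
      t ^ 2 * ((W.trace + 1) * (X * B).trace - A.trace * (X * B * V).trace) - (X * B).trace
          - t ^ 3 * (W.adjugate * X).trace := by
    have e : J.adjugate * (X * B) = B.adjugate * (a.adjugate * (B * X * B)) := by
      rw [hJ, adjugate_mul_distrib, adjugate_mul_distrib, adjugate_adjugate _ (by simp), h.det_B]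
      simp [mul_assoc]
    have e2 : a.adjugate = t ^ 2 • W.adjugate - 1 - t ^ 3 • (W.adjugate * B.adjugate) := by
      rw [ha, hK, adjugate_sub_fin_two, adjugate_sub_fin_two, adjugate_smul_fin_two,
        adjugate_smul_fin_two, adjugate_one, adjugate_mul_distrib]
    have e3 : (W.adjugate * (B * X)).trace =
        (W.trace + 1) * (X * B).trace - A.trace * (X * B * V).trace := by
      have e4 : (W * (B * X)).trace = A.trace * (X * B * V).trace - (X * B).trace := by
        rw [← mul_assoc, trace_mul_comm, ← mul_assoc, h.comm, mul_assoc, trace_mul_comm,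
          h.trace_XBW]
      rw [trace_adjugate_mul, e4, trace_mul_comm B]
      ring
    rw [e, trace_mul_comm, mul_assoc, mul_assoc (B * X), hB', mul_one, e2]
    simp only [sub_mul, smul_mul_assoc, one_mul, trace_sub, trace_smul, smul_eq_mul, mul_assoc]
    rw [← mul_assoc B.adjugate, hB, one_mul, e3, trace_mul_comm B, mul_assoc]
  have t2 : ((t • V - 1).adjugate * (X * B) * K).trace =
      (t ^ 2 - A.trace * t + 1) * ((X * B * V).trace * t + (X * B).trace) := by
    have e1 : (X * B * A.adjugate * W).trace = (X * B * V).trace := by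
      have hAW : A.adjugate * W = V := by simpa using h.adjugate_A_mul 1
      rw [mul_assoc, hAW]
    have e2 : (X * B * A.adjugate).trace = A.trace * (X * B).trace - (X * B * V).trace := by
      rw [trace_mul_comm, trace_adjugate_mul, trace_mul_comm A, h.trace_XBA]
    rw [adjugate_sub_fin_two, adjugate_smul_fin_two, adjugate_one, sub_mul, smul_mul_assoc, hYV, hK]
    simp only [sub_mul, mul_sub, smul_mul_assoc, mul_smul_comm, one_mul, mul_one, trace_sub,
      trace_smul, smul_eq_mul, e1, e2, h.trace_XBW]
    ring
  have s1 : J.adjugate * (t • V - 1).adjugate * (X * B * (t • A - 1)) =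
      (t • V - 1).det • (J.adjugate * (X * B)) := by
    rw [← hY, mul_assoc, ← mul_assoc _ _ (X * B), adjugate_mul, smul_mul_assoc, one_mul,
      mul_smul_comm]
  have s2 : (J.adjugate * (t • V - 1).adjugate * (X * B * (K * J))).trace =
      J.det * ((t • V - 1).adjugate * (X * B) * K).trace := by
    have : J.adjugate * (t • V - 1).adjugate * (X * B * (K * J)) =
        J.adjugate * ((t • V - 1).adjugate * (X * B) * K) * J := by simp only [mul_assoc]
    rw [this, trace_mul_comm, ← mul_assoc, mul_adjugate, smul_mul_assoc, one_mul, trace_smul,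
      smul_eq_mul]
  rw [adjugate_mul_distrib, mul_add, mul_add, trace_add, s1, s2, trace_smul, smul_eq_mul, hdV, hdJ,
    t1, t2]
  ring

/-- The determinant of the block matrix of Fox derivatives in terms of the traces of `A`, `W`,
`B W`, `X B`, `X B V` and `W⁻¹ X`. -/
theorem det_blocks (h : KnotMatrices A B V W X) (t u : R) (S : Matrix (Fin 2) (Fin 2) R)
    (ht : IsUnit t) (hS : S * (t ^ 2 • W - 1) = u • X - 1) :
    (fromBlocks (t ^ 2 • W - 1 - t ^ 3 • (B * W)) (1 - t • B)
        ((t • V - 1) * (u • X)) ((t • V - 1) * S - (t * u) • (X * B))).det *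
      (t ^ 4 - W.trace * t ^ 2 + 1) =
    (t ^ 2 - A.trace * t + 1) *
      ((1 - W.trace * t ^ 2 + (B * W).trace * t ^ 3 + t ^ 4 - A.trace * t ^ 5 + t ^ 6) +
      u * t * (t ^ 2 * ((W.trace + 1) * (X * B).trace - A.trace * (X * B * V).trace)
          - (X * B).trace - t ^ 3 * (W.adjugate * X).trace
          + (1 - W.trace * t ^ 2 + (B * W).trace * t ^ 3 + t ^ 4 - A.trace * t ^ 5 + t ^ 6) *
            ((X * B * V).trace * t + (X * B).trace)) +
      u ^ 2 * (t ^ 4 - A.trace * t ^ 5 + t ^ 6 + (B * W).trace * t ^ 7 - W.trace * t ^ 8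
        + t ^ 10)) := by
  rw [h.det_blocks_mul t u S ht hS, det_add_fin_two, mul_smul_comm, trace_smul, smul_eq_mul,
    h.trace_linear_part, det_smul, det_mul (X * B), h.det_quadratic_part, h.det_XB, det_mul,
    det_mul, det_mul, h.det_first_block, det_adjugate, h.det_B, det_smul_sub_one _ h.det_V,
    h.trace_V]
  simp only [Fintype.card_fin]
  ring

end KnotMatrices

/-! ### Palindromic polynomials with telescoping coefficients -/

theorem sum_range_two_mul {M : Type*} [AddCommMonoid M] (f : ℕ → M) (n : ℕ) :
    ∑ i ∈ Finset.range (2 * n), f i = ∑ k ∈ Finset.range n, (f (2 * k) + f (2 * k + 1)) := by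
  induction n with
  | zero => simp
  | succ n ih =>
    rw [mul_add, mul_one, Finset.sum_range_succ, Finset.sum_range_succ, Finset.sum_range_succ, ih,
      add_assoc]

/-- A palindromic polynomial of degree `4 n + 6`, the coefficients of which in each parity are
combinations of `s ^ k` and `s⁻¹ ^ k`, times the quadratic polynomial in `t²` with the roots
`s` and `s⁻¹`: the sums telescope. -/
theorem quadratic_mul_palindromic {R : Type*} [CommRing R] (n : ℕ) (s s' c δ ν τ t : R)
    (hs : s * s' = 1) (hν : ν * (s - s') = 1) :
    (t ^ 4 - (s + s') * t ^ 2 + 1) *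
      (1 + (∑ k ∈ Finset.range n,
        (τ * (s ^ (k + 1) - (s ^ (k + 2) - s' ^ k) * c) *
            (t ^ (2 * k + 3) + t ^ (4 * n - 2 * k + 3))
          + ν * (s ^ k - s' ^ k) * (t ^ (2 * k + 4) + t ^ (4 * n - 2 * k + 2))))
        + δ * (t ^ (2 * n + 2) + t ^ (2 * n + 4)) + t ^ (4 * n + 6)) =
      (1 - (s + s') * t ^ 2 + τ * (s - (s ^ 2 - 1) * c) * t ^ 3 + t ^ 4 - τ * t ^ 5 + t ^ 6)
      + t ^ (2 * n) * (δ * (t ^ 2 + (1 - (s + s')) * t ^ 4 + (1 - (s + s')) * t ^ 6 + t ^ 8)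
        - τ * (s ^ n * (s - s ^ 2 * c) + s' ^ n * c) * (t ^ 3 + t ^ 7)
        + 2 * τ * (s ^ n * (1 - s * c) + s' ^ n * (s * c)) * t ^ 5
        + ν * (s' - 1) * (s ^ n + s * s' ^ n) * (t ^ 4 + t ^ 6))
      + (t ^ (2 * n)) ^ 2 * (t ^ 4 - τ * t ^ 5 + t ^ 6 + τ * (s - (s ^ 2 - 1) * c) * t ^ 7
        - (s + s') * t ^ 8 + t ^ 10) := by
  have g1 := geom_sum_mul (s * t ^ 2) n
  have g2 := geom_sum_mul (s' * t ^ 2) n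
  have g3 := geom_sum₂_mul s (t ^ 2) n
  have g4 := geom_sum₂_mul s' (t ^ 2) n
  have hsum : (∑ k ∈ Finset.range n,
        (τ * (s ^ (k + 1) - (s ^ (k + 2) - s' ^ k) * c) *
            (t ^ (2 * k + 3) + t ^ (4 * n - 2 * k + 3))
          + ν * (s ^ k - s' ^ k) * (t ^ (2 * k + 4) + t ^ (4 * n - 2 * k + 2)))) =
      (τ * t ^ 3 * (s - s ^ 2 * c) + ν * t ^ 4) * (∑ k ∈ Finset.range n, (s * t ^ 2) ^ k)
      + (τ * t ^ 3 * c - ν * t ^ 4) * (∑ k ∈ Finset.range n, (s' * t ^ 2) ^ k)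
      + t ^ (2 * n) * (τ * t ^ 5 * (s - s ^ 2 * c) + ν * t ^ 4) *
          (∑ k ∈ Finset.range n, s ^ k * (t ^ 2) ^ (n - 1 - k))
      + t ^ (2 * n) * (τ * t ^ 5 * c - ν * t ^ 4) *
          (∑ k ∈ Finset.range n, s' ^ k * (t ^ 2) ^ (n - 1 - k)) := by
    simp only [Finset.mul_sum, ← Finset.sum_add_distrib]
    refine Finset.sum_congr rfl fun k hk => ?_
    have hk := Finset.mem_range.1 hk
    have e1 : t ^ (4 * n - 2 * k + 3) = t ^ (2 * n) * t ^ 5 * (t ^ 2) ^ (n - 1 - k) := by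
      rw [← pow_mul, ← pow_add, ← pow_add]; congr 1; omega
    have e2 : t ^ (4 * n - 2 * k + 2) = t ^ (2 * n) * t ^ 4 * (t ^ 2) ^ (n - 1 - k) := by
      rw [← pow_mul, ← pow_add, ← pow_add]; congr 1; omega
    rw [e1, e2]
    ring
  rw [hsum]
  set S1 := ∑ k ∈ Finset.range n, (s * t ^ 2) ^ k
  set S2 := ∑ k ∈ Finset.range n, (s' * t ^ 2) ^ k
  set S3 := ∑ k ∈ Finset.range n, s ^ k * (t ^ 2) ^ (n - 1 - k)
  set S4 := ∑ k ∈ Finset.range n, s' ^ k * (t ^ 2) ^ (n - 1 - k)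
  have hT : t ^ (2 * n + 2) = t ^ (2 * n) * t ^ 2 := pow_add _ _ _
  have hT' : t ^ (2 * n + 4) = t ^ (2 * n) * t ^ 4 := pow_add _ _ _
  have hT2 : t ^ (4 * n + 6) = (t ^ (2 * n)) ^ 2 * t ^ 6 := by ring
  rw [hT, hT', hT2]
  rw [mul_pow, ← pow_mul] at g1 g2
  rw [← pow_mul] at g3 g4
  set T := t ^ (2 * n)
  set q := s ^ n
  set q' := s' ^ n
  have hD : t ^ 4 - (s + s') * t ^ 2 + 1 = (s * t ^ 2 - 1) * (s' * t ^ 2 - 1) := by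
    linear_combination (-t ^ 4) * hs
  have f1 : (t ^ 4 - (s + s') * t ^ 2 + 1) * S1 = (s' * t ^ 2 - 1) * (q * T - 1) := by
    rw [hD]; linear_combination (s' * t ^ 2 - 1) * g1
  have f2 : (t ^ 4 - (s + s') * t ^ 2 + 1) * S2 = (s * t ^ 2 - 1) * (q' * T - 1) := by
    rw [hD]; linear_combination (s * t ^ 2 - 1) * g2
  have f3 : (t ^ 4 - (s + s') * t ^ 2 + 1) * S3 = (t ^ 2 - s') * (T - q) := by
    linear_combination (s' - t ^ 2) * g3 - S3 * hs
  have f4 : (t ^ 4 - (s + s') * t ^ 2 + 1) * S4 = (t ^ 2 - s) * (T - q') := by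
    linear_combination (s - t ^ 2) * g4 - S4 * hs
  linear_combination (τ * t ^ 3 * (s - s ^ 2 * c) + ν * t ^ 4) * f1
    + (τ * t ^ 3 * c - ν * t ^ 4) * f2 + T * (τ * t ^ 5 * (s - s ^ 2 * c) + ν * t ^ 4) * f3
    + T * (τ * t ^ 5 * c - ν * t ^ 4) * f4 + (t ^ 6 + T ^ 2 * t ^ 4) * hν
    + (τ * t ^ 5 * (1 - s * c) * (2 * T * q - T ^ 2 - 1) - (t ^ 4 + t ^ 6) * T * q' * ν) * hs

/-! ### Algebraic relations between the parameters -/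

/-- The polynomial `r₀` in terms of `u = s ^ (2 n)`. -/
def rootPoly (m s u : ℂ) : ℂ :=
  m ^ 8 * ((s - 1) * (s + 1) ^ 2 * (u - s ^ 2) * (u * s ^ 2))
  - m ^ 6 * (u ^ 3 * s ^ 3
      + (2 * s ^ 6 + s ^ 5 - 4 * s ^ 4 + s ^ 3 + s ^ 2 - s - 1) * (u ^ 2 * s)
      - (s ^ 6 + s ^ 5 - s ^ 4 - s ^ 3 + 4 * s ^ 2 - s - 2) * (u * s ^ 2) + s ^ 6)
  + m ^ 4 * ((s ^ 2 + 1) * (u ^ 3 * s ^ 2)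
      + (s ^ 6 + 2 * s ^ 5 - 3 * s ^ 4 - 2 * s ^ 3 + 6 * s ^ 2 - 4 * s - 2) * (u ^ 2 * s ^ 3)
      - (2 * s ^ 6 + 4 * s ^ 5 - 6 * s ^ 4 + 2 * s ^ 3 + 3 * s ^ 2 - 2 * s - 1) * u
      + (s ^ 2 + 1) * s ^ 5)
  - m ^ 2 * (u ^ 3 * s ^ 3
      + (2 * s ^ 6 + s ^ 5 - 4 * s ^ 4 + s ^ 3 + s ^ 2 - s - 1) * (u ^ 2 * s)
      - (s ^ 6 + s ^ 5 - s ^ 4 - s ^ 3 + 4 * s ^ 2 - s - 2) * (u * s ^ 2) + s ^ 6)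
  + (s - 1) * (s + 1) ^ 2 * (u - s ^ 2) * (u * s ^ 2)

/-- The polynomial `α` in terms of `u = s ^ (2 n)`. -/
def alphaPoly (m s u : ℂ) : ℂ :=
  (s ^ 2 - 1) * u *
    (-m ^ 6 * (s - 1) * s ^ 2 * (u * s + 1)
      + m ^ 4 * (u * s ^ 2 * (s ^ 4 - 2 * s ^ 2 + 3 * s - 1) + s ^ 4 - 3 * s ^ 3 + 2 * s ^ 2 - 1)
      - m ^ 2 * s * (u * (2 * s ^ 3 - s ^ 2 + 1) - s * (s ^ 3 - s + 2))
      + s ^ 2 * (u - s ^ 2))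

/-- The polynomial `β` in terms of `u = s ^ (2 n)`. -/
def betaPoly (m s u : ℂ) : ℂ :=
  m ^ 7 * (u * s ^ 2) * (s ^ 2 - 1) * (s ^ 3 + 1)
  - m ^ 5 * s * (s ^ 2 * u ^ 2 * (s ^ 3 - s ^ 2 + 1)
      + u * (s - 1) * (s ^ 3 + s + 1) * (s ^ 3 + s ^ 2 + 1) - s ^ 2 * (s ^ 3 - s + 1))
  + m ^ 3 * s ^ 2 * (s ^ 3 + 1) * (u - 1) * (u + s ^ 2)
  - m * s ^ 3 * (u - s ^ 2) * (u + s)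

theorem rZero_eq (n : ℕ) (m s : ℂ) : rZero n m s = rootPoly m s (s ^ (2 * n)) := by
  unfold rZero rootPoly
  ring

theorem alpha_eq (n : ℕ) (m s : ℂ) : alpha n m s = alphaPoly m s (s ^ (2 * n)) := by
  unfold alpha alphaPoly
  ring

theorem beta_eq (n : ℕ) (hn : 1 ≤ n) (m s : ℂ) : beta n m s = betaPoly m s (s ^ (2 * n)) := by
  have h : s ^ 3 * s ^ (2 * n - 2) = s * s ^ (2 * n) := by
    rw [← pow_add, ← pow_succ']
    congr 1
    omega
  unfold beta betaPoly
  linear_combination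
    -m ^ 5 * ((s - 1) * (s ^ 3 + s + 1) * (s ^ 3 + s ^ 2 + 1)) * h

/-- Up to a factor, the condition `v (x b) = (x b) a` on the parameter `p` of the matrix of `b`. -/
def conjRel (m s u p : ℂ) : ℂ :=
  m * s * u * (1 - m ^ 2 * s + m ^ 2 * s * u - s ^ 2 * u) * p ^ 2
    + (m ^ 4 - 1) * s * (s + 1) * u * p + m * (m ^ 2 * (1 - s ^ 2 * u) + s * (u - 1))

/-- The first of two linear equations for the parameter `p` of the matrix of `b`, which hold when
`s` is a root of `r₀`. -/
def linRel (m s u p : ℂ) : ℂ :=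
  p * (-m ^ 4 * s ^ 6 * u + 2 * m ^ 4 * s ^ 4 * u - m ^ 4 * s ^ 4 + m ^ 4 * s ^ 3 * u ^ 2
    - 2 * m ^ 4 * s ^ 3 * u + m ^ 4 * s * u - m ^ 2 * s ^ 6 * u - m ^ 2 * s ^ 4 * u ^ 2
    + 2 * m ^ 2 * s ^ 4 * u - 2 * m ^ 2 * s ^ 3 * u + m ^ 2 * s ^ 3 + m ^ 2 * s * u + s ^ 5 * u
    + s ^ 4 * u - s ^ 3 * u - s ^ 2 * u)
    + (-m ^ 5 * s ^ 4 * u + m ^ 5 * s ^ 4 + m ^ 5 * s ^ 2 * u - m ^ 5 * s ^ 2 + m ^ 3 * s ^ 6 * u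
    + m ^ 3 * s ^ 5 * u - m ^ 3 * s ^ 5 - 2 * m ^ 3 * s ^ 4 * u + m ^ 3 * s ^ 4
    + m ^ 3 * s ^ 2 * u - 2 * m ^ 3 * s ^ 2 - m ^ 3 * s * u + m ^ 3 * s + m ^ 3 - m * s ^ 4 * u
    + m * s ^ 4 + m * s ^ 2 * u - m * s ^ 2)

/-- The second of the linear equations for `p`. -/
def linRel' (m s u p : ℂ) : ℂ :=
  p * (-m ^ 6 * s ^ 5 * u - m ^ 6 * s ^ 4 * u + m ^ 6 * s ^ 3 * u ^ 2 + m ^ 6 * s ^ 2 * u ^ 2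
    + m ^ 4 * s ^ 6 * u - m ^ 4 * s ^ 5 * u ^ 2 - 2 * m ^ 4 * s ^ 4 * u ^ 2
    + 2 * m ^ 4 * s ^ 3 * u + m ^ 4 * s ^ 2 * u - m ^ 4 * s * u ^ 2 + m ^ 2 * s ^ 6 * u ^ 2
    + m ^ 2 * s ^ 6 * u + m ^ 2 * s ^ 5 * u ^ 2 - m ^ 2 * s ^ 5 * u - m ^ 2 * s ^ 4 * u ^ 2
    - m ^ 2 * s ^ 4 * u + m ^ 2 * s ^ 3 * u ^ 2 + m ^ 2 * s ^ 3 * u + m ^ 2 * s ^ 2 * u ^ 2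
    - m ^ 2 * s ^ 2 * u - m ^ 2 * s * u ^ 2 - m ^ 2 * s * u - s ^ 5 * u - s ^ 4 * u ^ 2
    + s ^ 3 * u + s ^ 2 * u ^ 2)
    + (m ^ 5 * s ^ 5 * u + m ^ 5 * s ^ 4 * u - m ^ 5 * s ^ 4 - 2 * m ^ 5 * s ^ 3 * u
    - m ^ 5 * s ^ 2 * u ^ 2 + m ^ 5 * s ^ 2 * u + m ^ 5 * s * u - m ^ 3 * s ^ 6 * u
    + m ^ 3 * s ^ 5 + m ^ 3 * s ^ 4 * u + m ^ 3 * s ^ 3 * u ^ 2 - 4 * m ^ 3 * s ^ 3 * u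
    + m ^ 3 * s ^ 3 + m ^ 3 * s ^ 2 * u + m ^ 3 * s * u ^ 2 - m ^ 3 * u + m * s ^ 5 * u
    + m * s ^ 4 * u - m * s ^ 4 - 2 * m * s ^ 3 * u - m * s ^ 2 * u ^ 2 + m * s ^ 2 * u
    + m * s * u)

/-- The equations satisfied by the parameters `m`, `s`, `u = s ^ (2 n)` and `p = β / (s α)`. Only
these are used in the computations with matrices, so that `α`, `β` and `r₀` can be forgotten. -/
structure IsParam (m s u p : ℂ) : Prop where
  m_ne : m ≠ 0
  s_ne : s ≠ 0
  u_ne : u ≠ 0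
  p_ne : p ≠ 0
  add_ne : s + 1 ≠ 0
  sub_ne : s - 1 ≠ 0
  den_ne : s * u + 1 ≠ 0
  bigH_ne : 1 - m ^ 2 * s + m ^ 2 * s * u - s ^ 2 * u ≠ 0
  conj : conjRel m s u p = 0
  lin : linRel m s u p = 0
  lin' : linRel' m s u p = 0

/-- For `p = β / (s α)`, the polynomial `α² conjRel` is a multiple of `r₀`. -/
theorem conjRel_of_root {m s u p : ℂ} (hr : rootPoly m s u = 0)
    (hp : s * alphaPoly m s u * p = betaPoly m s u) (hs : s ≠ 0) (hα : alphaPoly m s u ≠ 0) :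
    conjRel m s u p = 0 := by
  have key : m * s * u * (1 - m ^ 2 * s + m ^ 2 * s * u - s ^ 2 * u) * betaPoly m s u ^ 2
      + (m ^ 4 - 1) * s * (s + 1) * u * betaPoly m s u * (s * alphaPoly m s u)
      + m * (m ^ 2 * (1 - s ^ 2 * u) + s * (u - 1)) * (s * alphaPoly m s u) ^ 2 =
    (m ^ 9 * (s ^ 9 * u ^ 2 - s ^ 7 * u ^ 2 + s ^ 6 * u ^ 2 - s ^ 4 * u ^ 2)
    + m ^ 7 * (-s ^ 11 * u ^ 3 + 2 * s ^ 10 * u ^ 3 - s ^ 10 * u ^ 2 - s ^ 9 * u ^ 3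
    - 2 * s ^ 8 * u ^ 3 - s ^ 8 * u ^ 2 + s ^ 8 * u + 2 * s ^ 7 * u ^ 3 - s ^ 7 * u ^ 2
    + s ^ 6 * u ^ 2 - 2 * s ^ 6 * u - s ^ 5 * u ^ 3 + s ^ 5 * u ^ 2 + 2 * s ^ 5 * u + s ^ 4 * u + s ^ 3 * u ^ 2
    - 2 * s ^ 3 * u + s ^ 2 * u)
    + m ^ 5 * (s ^ 10 * u ^ 3 - s ^ 10 * u ^ 2 + 4 * s ^ 9 * u ^ 2 - s ^ 9 * u - s ^ 8 * u ^ 3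
    + 2 * s ^ 7 * u ^ 3 - 6 * s ^ 7 * u ^ 2 + 6 * s ^ 6 * u ^ 2 - 2 * s ^ 6 * u + s ^ 5 * u
    + s ^ 4 * u ^ 3 - 4 * s ^ 4 * u ^ 2 + s ^ 3 * u ^ 2 - s ^ 3 * u)
    + m ^ 3 * (s ^ 9 * u ^ 2 - 2 * s ^ 8 * u ^ 3 + 2 * s ^ 8 * u + s ^ 7 * u ^ 3 - 2 * s ^ 7 * u ^ 2
    + 2 * s ^ 6 * u ^ 2 - s ^ 6 * u - 2 * s ^ 5 * u ^ 3 + 2 * s ^ 5 * u - s ^ 4 * u ^ 2)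
    + m * (-s ^ 8 * u ^ 2 - s ^ 7 * u + s ^ 6 * u ^ 3 + s ^ 5 * u ^ 2)) * rootPoly m s u := by
    unfold rootPoly alphaPoly betaPoly
    ring
  have h : (s * alphaPoly m s u) ^ 2 * conjRel m s u p = 0 := by
    rw [hr, mul_zero, ← hp] at key
    rw [← key, conjRel]
    ring
  exact (mul_eq_zero.1 h).resolve_left (pow_ne_zero _ (mul_ne_zero hs hα))

/-- For `p = β / (s α)`, the polynomial `α linRel` is a multiple of `r₀`. -/
theorem linRel_of_root {m s u p : ℂ} (hr : rootPoly m s u = 0)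
    (hp : s * alphaPoly m s u * p = betaPoly m s u) (hs : s ≠ 0) (hα : alphaPoly m s u ≠ 0) :
    linRel m s u p = 0 := by
  have key : s * alphaPoly m s u * (linRel m s u p - linRel m s u 0)
      + s * alphaPoly m s u * linRel m s u 0 =
      (linRel m s u 1 - linRel m s u 0) * betaPoly m s u
        + s * alphaPoly m s u * linRel m s u 0 := by
    rw [← hp]; unfold linRel; ring
  have key2 : (linRel m s u 1 - linRel m s u 0) * betaPoly m s u
        + s * alphaPoly m s u * linRel m s u 0 =
    (m ^ 3 * (s ^ 6 * u - s ^ 5 * u + s ^ 4 + s ^ 3 * u - s ^ 2 + s)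
    + m * (-s ^ 4 * u - s ^ 3)) * rootPoly m s u := by
    unfold rootPoly alphaPoly betaPoly linRel
    ring
  rw [hr, mul_zero] at key2
  have h : s * alphaPoly m s u * linRel m s u p = 0 := by linear_combination key + key2
  exact (mul_eq_zero.1 h).resolve_left (mul_ne_zero hs hα)

/-- For `p = β / (s α)`, the polynomial `α linRel'` is a multiple of `r₀`. -/
theorem linRel'_of_root {m s u p : ℂ} (hr : rootPoly m s u = 0)
    (hp : s * alphaPoly m s u * p = betaPoly m s u) (hs : s ≠ 0) (hα : alphaPoly m s u ≠ 0) :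
    linRel' m s u p = 0 := by
  have key : s * alphaPoly m s u * (linRel' m s u p - linRel' m s u 0)
      + s * alphaPoly m s u * linRel' m s u 0 =
      (linRel' m s u 1 - linRel' m s u 0) * betaPoly m s u
        + s * alphaPoly m s u * linRel' m s u 0 := by
    rw [← hp]; unfold linRel'; ring
  have key2 : (linRel' m s u 1 - linRel' m s u 0) * betaPoly m s u
        + s * alphaPoly m s u * linRel' m s u 0 =
    (m ^ 5 * (s ^ 5 * u + s ^ 2 * u)
    + m ^ 3 * (-s ^ 6 * u + s ^ 5 * u - 2 * s ^ 4 * u - 2 * s ^ 3 * u + s ^ 2 * u - s * u)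
    + m * (s ^ 5 * u + s ^ 2 * u)) * rootPoly m s u := by
    unfold rootPoly alphaPoly betaPoly linRel'
    ring
  rw [hr, mul_zero] at key2
  have h : s * alphaPoly m s u * linRel' m s u p = 0 := by linear_combination key + key2
  exact (mul_eq_zero.1 h).resolve_left (mul_ne_zero hs hα)

/-- The root `s` of `r₀` gives parameters. The factor `s² - 1` of `α` shows that `s ≠ ±1`. -/
theorem IsParam.of_root {n : ℕ} (hn : 1 ≤ n) {m s : ℂ} (hm : m ≠ 0) (hs : s ≠ 0)
    (hroot : rZero n m s = 0) (hα : alpha n m s ≠ 0) (hβ : beta n m s ≠ 0)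
    (hq : s ^ (2 * n + 1) + 1 ≠ 0) (hH : bigH n m s ≠ 0) :
    IsParam m s (s ^ (2 * n)) (beta n m s / (s * alpha n m s)) := by
  have hp : s * alpha n m s * (beta n m s / (s * alpha n m s)) = beta n m s :=
    mul_div_cancel₀ _ (mul_ne_zero hs hα)
  have hp0 : beta n m s / (s * alpha n m s) ≠ 0 := div_ne_zero hβ (mul_ne_zero hs hα)
  generalize beta n m s / (s * alpha n m s) = p at hp hp0 ⊢
  have hss : s ^ 2 - 1 ≠ 0 := by
    intro h
    rw [alpha, h] at hα
    simp at hα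
  rw [rZero_eq] at hroot
  rw [alpha_eq] at hα hp
  rw [beta_eq n hn] at hp
  exact
    { m_ne := hm
      s_ne := hs
      u_ne := pow_ne_zero _ hs
      p_ne := hp0
      add_ne := fun h => hss (by linear_combination (s - 1) * h)
      sub_ne := fun h => hss (by linear_combination (s + 1) * h)
      den_ne := by rwa [pow_succ'] at hq
      bigH_ne := fun h => hH (by rw [bigH]; linear_combination h)
      conj := conjRel_of_root hroot hp hs hα
      lin := linRel_of_root hroot hp hs hα
      lin' := linRel'_of_root hroot hp hs hα }

/-- The upper left entry of `w b v = b w b`, up to a factor. -/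
theorem IsParam.braid_zero_zero {m s u p : ℂ} (h : IsParam m s u p) :
    -p ^ 3 * m * s ^ 2 * u + p ^ 3 * m * u + p ^ 2 * m ^ 2 * s ^ 2 * u - p ^ 2 * m ^ 2 * s ^ 2
    - p ^ 2 * m ^ 2 * s * u - p ^ 2 * m ^ 2 * u + p ^ 2 * s ^ 2 * u - p ^ 2 * u
    + p * m ^ 3 * s ^ 2 - p * m ^ 3 + p * m * s ^ 2 + p * m * s + p * m * u - p * m
    - m ^ 2 * s ^ 2 + m ^ 2 = 0 := by
  have h2 := h.conj
  have h3 := h.lin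
  have h4 := h.lin'
  unfold conjRel at h2
  unfold linRel at h3
  unfold linRel' at h4
  have key : m * s ^ 2 * u * (1 - m ^ 2 * s + m ^ 2 * s * u - s ^ 2 * u) ^ 3 *
      (-p ^ 3 * m * s ^ 2 * u + p ^ 3 * m * u + p ^ 2 * m ^ 2 * s ^ 2 * u - p ^ 2 * m ^ 2 * s ^ 2
    - p ^ 2 * m ^ 2 * s * u - p ^ 2 * m ^ 2 * u + p ^ 2 * s ^ 2 * u - p ^ 2 * u
    + p * m ^ 3 * s ^ 2 - p * m ^ 3 + p * m * s ^ 2 + p * m * s + p * m * u - p * m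
    - m ^ 2 * s ^ 2 + m ^ 2) = 0 := by
    -- the cofactors show that the left-hand side lies in the ideal of the three relations
    linear_combination
      (p * (m ^ 5 * (-s ^ 5 * u ^ 3 + 2 * s ^ 5 * u ^ 2 - s ^ 5 * u + s ^ 3 * u ^ 3
      - 2 * s ^ 3 * u ^ 2 + s ^ 3 * u)
      + m ^ 3 * (2 * s ^ 6 * u ^ 3 - 2 * s ^ 6 * u ^ 2 - 2 * s ^ 4 * u ^ 3 + 2 * s ^ 4 * u
      + 2 * s ^ 2 * u ^ 2 - 2 * s ^ 2 * u)
      + m * (-s ^ 7 * u ^ 3 + s ^ 5 * u ^ 3 + 2 * s ^ 5 * u ^ 2 - 2 * s ^ 3 * u ^ 2 - s ^ 3 * u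
      + s * u))
      + (m ^ 6 * (s ^ 5 * u ^ 3 - 2 * s ^ 5 * u ^ 2 + 2 * s ^ 5 * u - s ^ 5 - s ^ 4 * u ^ 3
      + 3 * s ^ 4 * u ^ 2 - 2 * s ^ 4 * u - s ^ 3 * u ^ 3 + s ^ 3 * u ^ 2 - s ^ 2 * u ^ 2
      + s ^ 2 * u)
      + m ^ 4 * (-2 * s ^ 6 * u ^ 3 + 3 * s ^ 6 * u ^ 2 - 2 * s ^ 6 * u + 3 * s ^ 5 * u ^ 3
      - 5 * s ^ 5 * u ^ 2 + s ^ 5 * u + 2 * s ^ 4 * u ^ 3 + s ^ 4 * u ^ 2 - 3 * s ^ 4 * u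
      + 2 * s ^ 4 - s ^ 3 * u ^ 3 + s ^ 3 * u ^ 2 + 2 * s ^ 3 * u - 2 * s ^ 2 * u ^ 2 + s ^ 2 * u
      - s * u)
      + m ^ 2 * (s ^ 7 * u ^ 3 - s ^ 7 * u ^ 2 - 3 * s ^ 6 * u ^ 3 + 2 * s ^ 6 * u ^ 2
      - s ^ 5 * u ^ 3
      - 3 * s ^ 5 * u ^ 2 + 3 * s ^ 5 * u + 2 * s ^ 4 * u ^ 3 + s ^ 4 * u ^ 2 - s ^ 4 * u
      + 3 * s ^ 3 * u ^ 2 - s ^ 3 - s ^ 2 * u ^ 2 - s * u)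
      + (s ^ 7 * u ^ 3 + s ^ 6 * u ^ 2 - s ^ 5 * u ^ 3 - s ^ 5 * u ^ 2 - s ^ 4 * u ^ 2 - s ^ 4 * u
      + s ^ 3 * u ^ 2 + s ^ 2 * u))) * h2
      + (m ^ 4 * (s ^ 2 * u ^ 3 - s ^ 2 * u ^ 2 + s * u ^ 2 - s * u)
    + m ^ 2 * (-2 * s ^ 3 * u ^ 3 + s ^ 3 * u ^ 2 - 2 * s ^ 2 * u ^ 2 + s ^ 2 * u + s * u ^ 2 + u)
    + (s ^ 4 * u ^ 3 + s ^ 3 * u ^ 2 - s ^ 2 * u ^ 2 - s * u)) * h3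
      + (m ^ 4 * (s ^ 2 * u ^ 2 - s ^ 2 * u + s * u - s)
    + m ^ 2 * (-s ^ 3 * u ^ 2 - s ^ 2 * u + s * u + 1)) * h4
  exact (mul_eq_zero.1 key).resolve_left (mul_ne_zero (mul_ne_zero (mul_ne_zero h.m_ne
    (pow_ne_zero _ h.s_ne)) h.u_ne) (pow_ne_zero _ h.bigH_ne))

/-- The lower left entry of `w b v = b w b`, up to a factor. -/
theorem IsParam.braid_one_zero {m s u p : ℂ} (h : IsParam m s u p) :
    -p ^ 3 * s ^ 5 * u ^ 2 - p ^ 3 * s ^ 4 * u + p ^ 3 * s ^ 3 * u ^ 2 + p ^ 3 * s ^ 2 * u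
    - p ^ 2 * m * s ^ 4 - 2 * p ^ 2 * m * s ^ 3 * u - p ^ 2 * m * s ^ 2 * u ^ 2
    + p * m ^ 2 * s ^ 4 + p * m ^ 2 * s ^ 3 * u - p * m ^ 2 * s ^ 2 - p * m ^ 2 * s * u
    + p * s ^ 4 + p * s ^ 3 * u - p * s ^ 2 - p * s * u - m * s ^ 4 + 2 * m * s ^ 2 - m = 0 := by
  have h2 := h.conj
  have h3 := h.lin
  have h4 := h.lin'
  unfold conjRel at h2
  unfold linRel at h3
  unfold linRel' at h4
  have key : m ^ 2 * s ^ 2 * u ^ 2 * (1 - m ^ 2 * s + m ^ 2 * s * u - s ^ 2 * u) ^ 2 *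
      (-p ^ 3 * s ^ 5 * u ^ 2 - p ^ 3 * s ^ 4 * u + p ^ 3 * s ^ 3 * u ^ 2 + p ^ 3 * s ^ 2 * u
    - p ^ 2 * m * s ^ 4 - 2 * p ^ 2 * m * s ^ 3 * u - p ^ 2 * m * s ^ 2 * u ^ 2
    + p * m ^ 2 * s ^ 4 + p * m ^ 2 * s ^ 3 * u - p * m ^ 2 * s ^ 2 - p * m ^ 2 * s * u
    + p * s ^ 4 + p * s ^ 3 * u - p * s ^ 2 - p * s * u - m * s ^ 4 + 2 * m * s ^ 2 - m) = 0 := by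
    -- the cofactors show that the left-hand side lies in the ideal of the three relations
    linear_combination
      (p * (m ^ 3 * (-s ^ 7 * u ^ 4 + s ^ 7 * u ^ 3 - s ^ 6 * u ^ 3 + s ^ 6 * u ^ 2 + s ^ 5 * u ^ 4
      - s ^ 5 * u ^ 3 + s ^ 4 * u ^ 3 - s ^ 4 * u ^ 2)
      + m * (s ^ 8 * u ^ 4 + s ^ 7 * u ^ 3 - s ^ 6 * u ^ 4 - s ^ 6 * u ^ 3 - s ^ 5 * u ^ 3
      - s ^ 5 * u ^ 2 + s ^ 4 * u ^ 3 + s ^ 3 * u ^ 2))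
      + (m ^ 4 * (s ^ 7 * u ^ 3 + s ^ 6 * u ^ 3 + s ^ 6 * u - 3 * s ^ 5 * u ^ 3 + 3 * s ^ 5 * u ^ 2
      - s ^ 4 * u ^ 4 - s ^ 4 * u ^ 2 - s ^ 3 * u ^ 2)
      + m ^ 2 * (s ^ 7 * u ^ 2 + 2 * s ^ 6 * u ^ 3 + s ^ 5 * u ^ 4 - s ^ 5 * u - 2 * s ^ 4 * u ^ 2
      - s ^ 3 * u ^ 3)
      + (-s ^ 7 * u ^ 3 - s ^ 6 * u ^ 3 - s ^ 6 * u ^ 2 + s ^ 5 * u ^ 3 - s ^ 5 * u ^ 2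
      + s ^ 4 * u ^ 3 + s ^ 4 * u ^ 2 + s ^ 3 * u ^ 2))) * h2
      + (m ^ 2 * (s ^ 4 * u ^ 3 + s ^ 3 * u ^ 3 + s ^ 3 * u ^ 2 + s ^ 2 * u ^ 2)
    + (-s ^ 4 * u ^ 3 - s ^ 3 * u ^ 3 - s ^ 3 * u ^ 2 - s ^ 2 * u ^ 2)) * h3
      + (m ^ 2 * (s ^ 4 * u ^ 3 + 2 * s ^ 3 * u ^ 2 + s ^ 2 * u)) * h4
  exact (mul_eq_zero.1 key).resolve_left (mul_ne_zero (mul_ne_zero (mul_ne_zero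
    (pow_ne_zero _ h.m_ne) (pow_ne_zero _ h.s_ne)) (pow_ne_zero _ h.u_ne))
    (pow_ne_zero _ h.bigH_ne))

/-! ### The matrices -/

/-- The matrix of `a`, where `u` stands for `s ^ (2 n)`. -/
noncomputable def repA (m s u : ℂ) : Matrix (Fin 2) (Fin 2) ℂ :=
  !![m, -((m ^ 2 - s) * (s * u + 1) / (m * (s + 1))); 0, m⁻¹]

/-- The matrix of `b`. It has trace `m + m⁻¹`, its two entries on the left are equal, and `p` stands
for `β / (s α)`. -/
noncomputable def repB (m p : ℂ) : Matrix (Fin 2) (Fin 2) ℂ :=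
  !![p, -((1 - m * p) * (m - p) / (m * p)); p, m + m⁻¹ - p]

/-- The matrix of the loop `w = a v`, with eigenvalues `s` and `s⁻¹`. -/
noncomputable def repW (s u : ℂ) : Matrix (Fin 2) (Fin 2) ℂ :=
  !![s, 0; (s - s⁻¹) / (s * u + 1), s⁻¹]

/-- The matrix of `v = y₁⁻¹`, determined by `w = a v`. -/
noncomputable def repV (m s u : ℂ) : Matrix (Fin 2) (Fin 2) ℂ :=
  !![m + m⁻¹ - m / s, (m ^ 2 - s) * (s * u + 1) / (m * s * (s + 1));
     m * (s - s⁻¹) / (s * u + 1), m / s]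

/-- The matrix of `x = w ^ n`, where `q` stands for `s ^ n`. -/
noncomputable def repX (s u q : ℂ) : Matrix (Fin 2) (Fin 2) ℂ :=
  !![q, 0; (q - q⁻¹) / (s * u + 1), q⁻¹]

theorem fin_two_eq {R : Type*} {a b c d a' b' c' d' : R} (h₁ : a = a') (h₂ : b = b') (h₃ : c = c')
    (h₄ : d = d') : !![a, b; c, d] = !![a', b'; c', d'] := by
  rw [h₁, h₂, h₃, h₄]

/-- If `V` and `B` in `SL₂` have the same trace, then `G V - B G` lies in a two-dimensional space,
and it vanishes as soon as its first column does, provided that the lower left entry of `V` is not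
zero. -/
theorem mul_eq_mul_of_col {F : Type*} [Field F] {V B G : Matrix (Fin 2) (Fin 2) F}
    (hV : V.det = 1) (hB : B.det = 1) (htr : B.trace = V.trace) (hV10 : V 1 0 ≠ 0)
    (h0 : (G * V) 0 0 = (B * G) 0 0) (h1 : (G * V) 1 0 = (B * G) 1 0) : G * V = B * G := by
  have e : (G * V - B * G) * V = B.adjugate * (G * V - B * G) := by
    have hV2 : V * V = V.trace • V - 1 := by
      have := mul_adjugate V
      rw [adjugate_eq_trace_smul_sub, hV, one_smul, mul_sub, mul_smul_comm, mul_one] at this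
      rw [← this]
      abel
    have hBB : B.adjugate * (B * G) = G := by
      rw [← mul_assoc, adjugate_mul, hB, one_smul, one_mul]
    rw [mul_sub, hBB, sub_mul, mul_assoc G, hV2, adjugate_eq_trace_smul_sub, htr]
    simp only [mul_sub, sub_mul, mul_smul_comm, smul_mul_assoc, mul_one, one_mul, mul_assoc]
    abel
  have f0 : (G * V - B * G) 0 0 = 0 := by rw [Matrix.sub_apply, h0, sub_self]
  have f1 : (G * V - B * G) 1 0 = 0 := by rw [Matrix.sub_apply, h1, sub_self]
  rw [← sub_eq_zero]
  generalize G * V - B * G = M at e f0 f1 ⊢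
  have e0 := congrFun (congrFun e 0) 0
  have e1 := congrFun (congrFun e 1) 0
  simp only [mul_apply, Fin.sum_univ_two, f0, f1, zero_mul, mul_zero, zero_add, add_zero,
    mul_eq_zero, hV10, or_false] at e0 e1
  ext i j
  fin_cases i <;> fin_cases j <;> simp [f0, f1, e0, e1]

/-- The relations hold for the matrices. The entries of `conj` are multiples of `conjRel`, and by
`mul_eq_mul_of_col` only the left column of `braid` has to be compared. -/
theorem IsParam.knotMatrices {m s u p q : ℂ} (h : IsParam m s u p) (hq : q ^ 2 = u) :
    KnotMatrices (repA m s u) (repB m p) (repV m s u) (repW s u) (repX s u q) := by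
  subst hq
  have hm := h.m_ne
  have hs := h.s_ne
  have hp := h.p_ne
  have h1 := h.add_ne
  have h2 := h.sub_ne
  have hQ := h.den_ne
  have hq : q ≠ 0 := fun h0 => h.u_ne (by rw [h0]; ring)
  have det_V : (repV m s (q ^ 2)).det = 1 := by
    rw [repV, det_fin_two_of]; field_simp; ring
  have det_B : (repB m p).det = 1 := by
    rw [repB, det_fin_two_of]; field_simp; ring
  have tr_V : (repV m s (q ^ 2)).trace = m + m⁻¹ := by
    rw [repV, trace_fin_two_of]; ring
  have tr_B : (repB m p).trace = m + m⁻¹ := by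
    rw [repB, trace_fin_two_of]; ring
  exact
    { det_A := by rw [repA, det_fin_two_of]; field_simp; ring
      det_B := det_B
      det_W := by rw [repW, det_fin_two_of]; field_simp; ring
      det_X := by rw [repX, det_fin_two_of]; field_simp; ring
      trace_B := by rw [tr_B, repA, trace_fin_two_of]
      mul_V := by
        rw [repA, repV, repW, mul_fin_two]
        apply fin_two_eq <;> field_simp <;> ring
      braid := by
        rw [mul_assoc (repB m p)]
        apply mul_eq_mul_of_col det_V det_B (tr_B.trans tr_V.symm)
        · change m * (s - s⁻¹) / (s * q ^ 2 + 1) ≠ 0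
          have : s - s⁻¹ = (s + 1) * (s - 1) / s := by field_simp; ring
          rw [this]
          exact div_ne_zero (mul_ne_zero hm (div_ne_zero (mul_ne_zero h1 h2) hs)) hQ
        · simp only [repB, repV, repW, mul_fin_two, of_apply, cons_val', cons_val_zero,
            cons_val_fin_one]
          linear_combination (norm := (field_simp; ring))
            1 / (m * p * (s * q ^ 2 + 1)) * h.braid_zero_zero
        · simp only [repB, repV, repW, mul_fin_two, of_apply, cons_val', cons_val_zero,
            cons_val_one, cons_val_fin_one]
          linear_combination (norm := (field_simp; ring))
            1 / (s ^ 2 * p * (s * q ^ 2 + 1) ^ 2) * h.braid_one_zero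
      conj := by
        have hc := h.conj
        rw [conjRel] at hc
        simp only [repA, repB, repV, repX, mul_fin_two]
        apply fin_two_eq
        · field_simp; ring
        · linear_combination (norm := (field_simp; ring))
            1 / (m ^ 2 * s * p * (s + 1) * q) * hc
        · field_simp; ring
        · linear_combination (norm := (field_simp; ring))
            1 / (m ^ 2 * s * p * (s * q ^ 2 + 1) * q) * hc
      comm := by
        simp only [repX, repW, mul_fin_two]
        apply fin_two_eq <;> field_simp <;> ring }

theorem repW_pow {s u : ℂ} (hs : s ≠ 0) (n : ℕ) : repW s u ^ n = repX s u (s ^ n) := by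
  induction n with
  | zero => simp [repX, Matrix.one_fin_two]
  | succ n ih =>
    have := pow_ne_zero n hs
    rw [pow_succ, ih, repX, repX, repW, mul_fin_two]
    apply fin_two_eq
    · ring
    · ring
    · rw [pow_succ]
      generalize s ^ n = q at *
      generalize s * u + 1 = Q
      field_simp
      ring
    · rw [pow_succ, mul_inv]; ring

/-! ### The traces that occur in the determinant -/

/-- The constant `(η₁ + η₂) / (H β)` in the coefficients `λ_i` with even `i`. -/
noncomputable def evenConst (m s u p : ℂ) : ℂ :=
  (u * (m ^ 2 - s) * s * p + m * (1 - s)) / ((1 - m ^ 2 * s + m ^ 2 * s * u - s ^ 2 * u) * s * p)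

/-- The constant `-(s² - 1) η₁ / (H β)` in the middle coefficient. -/
noncomputable def middleConst (m s u p : ℂ) : ℂ :=
  -((s ^ 2 - 1) * (u * (1 + m ^ 2) * s * p + m * (1 - u * s))) /
    ((1 - m ^ 2 * s + m ^ 2 * s * u - s ^ 2 * u) * s * p)

namespace IsParam

variable {m s u p q : ℂ}

theorem trace_BW (h : IsParam m s u p) :
    (repB m p * repW s u).trace = (m + m⁻¹) * (s - (s ^ 2 - 1) * evenConst m s u p) := by
  have hm := h.m_ne
  have hs := h.s_ne
  have hp := h.p_ne
  have hQ := h.den_ne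
  have hH := h.bigH_ne
  have hc := h.conj
  rw [conjRel] at hc
  rw [repB, repW, mul_fin_two, trace_fin_two_of, evenConst]
  generalize hHe : (1 - m ^ 2 * s + m ^ 2 * s * u - s ^ 2 * u) = H at hH ⊢
  linear_combination (norm := (field_simp; subst hHe; ring))
    (s + 1) * (s - 1) / (m * s * p * (s * u + 1) * H) * hc

theorem trace_XBV (h : IsParam m s u p) (hq : q ^ 2 = u) :
    (repX s u q * repB m p * repV m s u).trace = middleConst m s u p / q := by
  subst hq
  have hm := h.m_ne
  have hs := h.s_ne
  have hp := h.p_ne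
  have h1 := h.add_ne
  have hQ := h.den_ne
  have hH := h.bigH_ne
  have hc := h.conj
  have hq : q ≠ 0 := fun h0 => h.u_ne (by rw [h0]; ring)
  rw [conjRel] at hc
  rw [repX, repB, repV, mul_fin_two, mul_fin_two, trace_fin_two_of, middleConst]
  generalize hHe : (1 - m ^ 2 * s + m ^ 2 * s * q ^ 2 - s ^ 2 * q ^ 2) = H at hH ⊢
  generalize hQe : s * q ^ 2 + 1 = Q at hQ ⊢
  linear_combination (norm := (field_simp; subst hHe hQe; ring))
    (q ^ 2 - 1) / (p * Q * H * q) * hc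

theorem trace_XB (h : IsParam m s u p) (hq : q ^ 2 = u) :
    (repX s u q * repB m p).trace = (m + m⁻¹) * (middleConst m s u p -
      (u * s + (1 - u * s ^ 2) * evenConst m s u p)) / q := by
  subst hq
  have hm := h.m_ne
  have hs := h.s_ne
  have hp := h.p_ne
  have h1 := h.add_ne
  have hQ := h.den_ne
  have hH := h.bigH_ne
  have hc := h.conj
  have hq : q ≠ 0 := fun h0 => h.u_ne (by rw [h0]; ring)
  rw [conjRel] at hc
  rw [repX, repB, mul_fin_two, trace_fin_two_of, middleConst, evenConst]
  generalize hHe : (1 - m ^ 2 * s + m ^ 2 * s * q ^ 2 - s ^ 2 * q ^ 2) = H at hH ⊢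
  generalize hQe : s * q ^ 2 + 1 = Q at hQ ⊢
  linear_combination (norm := (field_simp; subst hHe hQe; ring))
    (q ^ 2 - 1) / (m * p * Q * H * q) * hc

theorem trace_adjugate_W_mul_X (s u q : ℂ) :
    ((repW s u).adjugate * repX s u q).trace = s⁻¹ * q + s * q⁻¹ := by
  rw [repW, repX, adjugate_fin_two_of, mul_fin_two, trace_fin_two_of]
  ring

/-- The condition that the coefficients of `t⁶` agree in the part of the determinant linear in
`t ^ (2 n)`. -/
theorem middleConst_eq (h : IsParam m s u p) :
    middleConst m s u p - (m + m⁻¹) * ((m + m⁻¹) * (middleConst m s u p -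
      (u * s + (1 - u * s ^ 2) * evenConst m s u p))) =
    middleConst m s u p * (1 - (s + s⁻¹)) - (u + s) / (s + 1) := by
  have hm := h.m_ne
  have hs := h.s_ne
  have hp := h.p_ne
  have h1 := h.add_ne
  have hH := h.bigH_ne
  have hc := h.lin
  rw [linRel] at hc
  rw [middleConst, evenConst]
  generalize hHe : (1 - m ^ 2 * s + m ^ 2 * s * u - s ^ 2 * u) = H at hH ⊢
  linear_combination (norm := (field_simp; subst hHe; ring))
    1 / (m ^ 2 * s ^ 2 * p * (s + 1) * H) * hc

/-- The condition that the coefficients of `t⁵` agree in the part of the determinant linear in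
`t ^ (2 n)`. -/
theorem quintic_coeff_eq (h : IsParam m s u p) :
    (m + m⁻¹) * (s - (s ^ 2 - 1) * evenConst m s u p) * middleConst m s u p
      + (m + m⁻¹) * (middleConst m s u p - (u * s + (1 - u * s ^ 2) * evenConst m s u p)) =
    2 * (m + m⁻¹) * (u * (1 - s * evenConst m s u p) + s * evenConst m s u p) := by
  have hm := h.m_ne
  have hs := h.s_ne
  have hu := h.u_ne
  have hp := h.p_ne
  have hH := h.bigH_ne
  have h2 := h.conj
  have h3 := h.lin
  have h4 := h.lin'
  rw [conjRel] at h2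
  rw [linRel] at h3
  rw [linRel'] at h4
  rw [middleConst, evenConst]
  generalize hHe : (1 - m ^ 2 * s + m ^ 2 * s * u - s ^ 2 * u) = H at hH ⊢
  -- the cofactors show that the difference lies in the ideal of the three relations
  linear_combination (norm := (field_simp; subst hHe; ring))
    (s - 1) * (m ^ 2 + 1) / (m ^ 2 * s ^ 3 * u * p ^ 2 * H ^ 3) *
        ((m ^ 4 * (s ^ 5 * u + s ^ 4 * u - s ^ 3 * u ^ 2 - s ^ 2 * u ^ 2)
    + m ^ 2 * (s ^ 5 * u + 2 * s ^ 4 * u ^ 2 - s ^ 4 * u + s ^ 3 * u ^ 2 - 2 * s ^ 3 * u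
    - s ^ 2 * u ^ 2)
    + (-s ^ 5 * u ^ 2 - s ^ 4 * u + s ^ 3 * u ^ 2 + s ^ 2 * u)) * h2
      + (m ^ 2 * (s ^ 2 * u + s * u ^ 2)
    + (-s ^ 2 * u ^ 2 - s * u)) * h3
      + (m ^ 2 * (s ^ 2 * u + s * u)) * h4)

/-- The condition that the coefficients of `t⁴` agree in the part of the determinant linear in
`t ^ (2 n)`. -/
theorem quartic_coeff_eq (h : IsParam m s u p) :
    (m + m⁻¹) * (s - (s ^ 2 - 1) * evenConst m s u p) * ((m + m⁻¹) * (middleConst m s u p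
      - (u * s + (1 - u * s ^ 2) * evenConst m s u p))) - (s⁻¹ * u + s)
      - (s + s⁻¹) * middleConst m s u p =
    middleConst m s u p * (1 - (s + s⁻¹)) - (u + s) / (s + 1) := by
  have hm := h.m_ne
  have hs := h.s_ne
  have hu := h.u_ne
  have hp := h.p_ne
  have h1 := h.add_ne
  have hH := h.bigH_ne
  have h2 := h.conj
  have h3 := h.lin
  have h4 := h.lin'
  rw [conjRel] at h2
  rw [linRel] at h3
  rw [linRel'] at h4
  rw [middleConst, evenConst]
  generalize hHe : (1 - m ^ 2 * s + m ^ 2 * s * u - s ^ 2 * u) = H at hH ⊢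
  -- the cofactors show that the difference lies in the ideal of the three relations
  linear_combination (norm := (field_simp; subst hHe; ring))
    -1 / (m ^ 3 * s ^ 2 * u * p ^ 2 * (s + 1) * H ^ 3) *
        ((m ^ 6 * (-s ^ 6 * u - 2 * s ^ 5 * u + s ^ 5 + 2 * s ^ 4 * u + 2 * s ^ 3 * u ^ 2
    + s ^ 2 * u ^ 3
    - 2 * s ^ 2 * u ^ 2 - s * u ^ 2)
    + m ^ 4 * (-s ^ 6 * u ^ 2 - s ^ 5 * u ^ 2 - s ^ 4 * u ^ 2 + 5 * s ^ 4 * u - 2 * s ^ 4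
    - 2 * s ^ 3 * u ^ 3 + 5 * s ^ 3 * u ^ 2 - s ^ 3 * u - s ^ 2 * u - s * u)
    + m ^ 2 * (s ^ 7 * u ^ 2 + s ^ 6 * u ^ 2 - s ^ 6 * u - s ^ 5 * u ^ 2 - s ^ 5 * u + s ^ 4 * u ^ 3
    - 2 * s ^ 4 * u ^ 2 + 2 * s ^ 4 * u + 2 * s ^ 3 * u ^ 2 - 2 * s ^ 3 * u + s ^ 3
    - s ^ 2 * u ^ 2 - s ^ 2 * u - s * u ^ 2 + s * u + u)
    + (-s ^ 5 * u ^ 2 + s ^ 5 * u - s ^ 4 * u ^ 2 + s ^ 4 * u + s ^ 3 * u ^ 2 - s ^ 3 * u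
    + s ^ 2 * u ^ 2 - s ^ 2 * u)) * h2
      + (m ^ 4 * (-s ^ 3 * u - 2 * s ^ 2 * u ^ 2 + s ^ 2 * u - s * u ^ 2 + 2 * s * u + u ^ 2)
    + m ^ 2 * (2 * s ^ 3 * u ^ 2 - s ^ 3 * u + s ^ 2 * u ^ 2 - s * u + u ^ 2 - 2 * u)
    + (-s ^ 2 * u ^ 2 + s ^ 2 * u - s * u ^ 2 + s * u)) * h3
      + (m ^ 4 * (-s ^ 3 * u - s ^ 2 * u ^ 2 + s + u)
    + m ^ 2 * (s ^ 3 * u ^ 2 - s ^ 3 * u + u - 1)) * h4)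

end IsParam

theorem trace_map_fin_two {R S : Type*} [CommRing R] [CommRing S] (f : R →+* S)
    (M : Matrix (Fin 2) (Fin 2) R) : (M.map f).trace = f M.trace := by
  rw [trace_fin_two, trace_fin_two, map_add]
  rfl

theorem KnotMatrices.map {R S : Type*} [CommRing R] [CommRing S]
    {A B V W X : Matrix (Fin 2) (Fin 2) R} (h : KnotMatrices A B V W X) (f : R →+* S) :
    KnotMatrices (A.map f) (B.map f) (V.map f) (W.map f) (X.map f) := by
  have hd : ∀ M : Matrix (Fin 2) (Fin 2) R, M.det = 1 → (M.map f).det = 1 := fun M hM => by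
    rw [← RingHom.mapMatrix_apply, ← RingHom.map_det, hM, map_one]
  exact
    { det_A := hd _ h.det_A
      det_B := hd _ h.det_B
      det_W := hd _ h.det_W
      det_X := hd _ h.det_X
      trace_B := by rw [trace_map_fin_two, trace_map_fin_two, h.trace_B]
      mul_V := by rw [← Matrix.map_mul, h.mul_V]
      braid := by simp only [← Matrix.map_mul, h.braid]
      conj := by simp only [← Matrix.map_mul, h.conj]
      comm := by simp only [← Matrix.map_mul, h.comm] }

/-! ### The representation -/

theorem genY_one_inv (n : ℕ) :
    (genY n 1)⁻¹ = genX n * genB n * genA n * (genX n * genB n)⁻¹ := by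
  refine (lift_knotRelators n (genA n) (genB n) (genY n 1)⁻¹).2.1 ?_
  rw [← mk_eq_lift]
  exact pretzelRel_two _

theorem hom_ext_of_gen {H : Type*} [Group H] {n : ℕ} {f g : KnotGroup n →* H}
    (ha : f (genA n) = g (genA n)) (hb : f (genB n) = g (genB n)) (hx : f (genX n) = g (genX n)) :
    f = g := by
  have hy : f (genY n 1) = g (genY n 1) := by
    rw [← _root_.inv_inj, ← map_inv, ← map_inv, genY_one_inv]
    simp only [map_mul, map_inv, ha, hb, hx]
  refine PresentedGroup.ext fun i => ?_
  fin_cases i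
  · exact hb
  · exact hy
  · exact ha

theorem exists_hom_of_relations {H : Type*} [Group H] (n : ℕ) (a b v : H)
    (h₁ : a * v * b * v = b * (a * v) * b) (h₂ : v * ((a * v) ^ n * b) = (a * v) ^ n * b * a) :
    ∃ ρ : KnotGroup n →* H, ρ (genA n) = a ∧ ρ (genB n) = b ∧ ρ (genY n 1) = v⁻¹ := by
  have r0 := (lift_knotRelators n a b v).1.2 h₁
  have r2 := (lift_knotRelators n a b v).2.2 (eq_mul_inv_of_mul_eq h₂)
  have hg : ∀ r ∈ Set.range (knotRelators n), FreeGroup.lift ![b, v⁻¹, a] r = 1 := by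
    rintro _ ⟨i, rfl⟩
    fin_cases i
    · exact r0
    · rw [pretzelRel_prod, map_inv, map_mul, inv_eq_one] at r2
      have r0' : FreeGroup.lift ![b, v⁻¹, a] (pretzelRel (knotTwists n) 0) = 1 := r0
      rw [r0', one_mul] at r2
      exact r2
  refine ⟨PresentedGroup.toGroup hg, ?_, ?_, ?_⟩ <;> simp [genA, genB, genY]

/-- A representation with the prescribed values on the generators. -/
theorem KnotMatrices.exists_rep {A B V W X : Matrix (Fin 2) (Fin 2) ℂ}
    (h : KnotMatrices A B V W X) {n : ℕ} (hX : W ^ n = X) :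
    ∃ ρ : KnotGroup n →* SpecialLinearGroup (Fin 2) ℂ,
      (ρ (genA n) : Matrix (Fin 2) (Fin 2) ℂ) = A ∧ (ρ (genB n) : Matrix (Fin 2) (Fin 2) ℂ) = B ∧
      (ρ (genX n) : Matrix (Fin 2) (Fin 2) ℂ) = X ∧
      (ρ (genY n 1)⁻¹ : Matrix (Fin 2) (Fin 2) ℂ) = V := by
  let a : SpecialLinearGroup (Fin 2) ℂ := ⟨A, h.det_A⟩
  let b : SpecialLinearGroup (Fin 2) ℂ := ⟨B, h.det_B⟩
  let v : SpecialLinearGroup (Fin 2) ℂ := ⟨V, h.det_V⟩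
  have hw : (a * v).1 = W := h.mul_V
  have hwn : ((a * v) ^ n).1 = X :=
    (Matrix.SpecialLinearGroup.coe_pow (a * v) n).trans ((congrArg (· ^ n) hw).trans hX)
  have h₁ : A * V * B * V = B * (A * V) * B := by rw [h.mul_V, h.braid]
  have h₂ : V * (((a * v) ^ n).1 * B) = ((a * v) ^ n).1 * B * A := by rw [hwn, h.conj]
  obtain ⟨ρ, ha, hb, hy⟩ := exists_hom_of_relations n a b v (Subtype.ext h₁) (Subtype.ext h₂)
  refine ⟨ρ, by rw [ha], by rw [hb], ?_, by rw [map_inv, hy, inv_inv]⟩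
  rw [genX, map_pow, map_mul, map_inv, hy, inv_inv]
  exact (congrArg (fun g => ((g * v) ^ n : SpecialLinearGroup (Fin 2) ℂ).1) ha).trans hwn

/-! ### Wada's invariant for two relators -/

section TwoRelators

variable {d : ℕ} {F : Type*} [Field F] (r : Fin 2 → FreeGroup (Fin 3))
  (ρ : Group1 r →* GL (Fin d) F) (α : Group1 r →* Multiplicative ℤ)

theorem det_wadaMatrix (j : Fin 3) :
    (wadaMatrix r ρ α j).det = (fromBlocks
      (wadaFox r ρ α (j.succAbove 0) (r 0)) (wadaFox r ρ α (j.succAbove 1) (r 0))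
      (wadaFox r ρ α (j.succAbove 0) (r 1)) (wadaFox r ρ α (j.succAbove 1) (r 1))).det := by
  let e : Fin d ⊕ Fin d ≃ Fin 2 × Fin d :=
    (Equiv.boolProdEquivSum (Fin d)).symm.trans (finTwoEquiv.symm.prodCongr (Equiv.refl _))
  rw [← det_submatrix_equiv_self e]
  congr 1
  ext (i | i) (j | j) <;> rfl

/-- Wada's quotient does not depend on the deleted column. -/
theorem det_wadaMatrix_mul_wadaDenom (hd : Even d) (j : Fin 3) :
    (wadaMatrix r ρ α j).det * wadaDenom r ρ α 1 =
      (wadaMatrix r ρ α 1).det * wadaDenom r ρ α j := by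
  have hc : Even (Fintype.card (Fin d)) := by rwa [Fintype.card_fin]
  have h : ∀ i, wadaFox r ρ α 0 (r i) * (wadaGroup r ρ α (FreeGroup.of 0) - 1)
      + wadaFox r ρ α 1 (r i) * (wadaGroup r ρ α (FreeGroup.of 1) - 1)
      + wadaFox r ρ α 2 (r i) * (wadaGroup r ρ α (FreeGroup.of 2) - 1) = 0 := fun i => by
    have := sum_wadaFox_mul r ρ α (r i)
    rwa [wadaGroup_relator, sub_self, Fin.sum_univ_three] at this
  have h' : ∀ i, wadaFox r ρ α 2 (r i) * (wadaGroup r ρ α (FreeGroup.of 2) - 1)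
      + wadaFox r ρ α 1 (r i) * (wadaGroup r ρ α (FreeGroup.of 1) - 1)
      + wadaFox r ρ α 0 (r i) * (wadaGroup r ρ α (FreeGroup.of 0) - 1) = 0 := fun i => by
    rw [← h i]
    abel
  simp only [wadaDenom_eq, det_wadaMatrix]
  fin_cases j
  · exact det_fromBlocks_mul_det_eq hc _ _ _ _ _ _ _ _ _ (h 0) (h 1)
  · rfl
  · have := det_fromBlocks_mul_det_eq hc _ _ _ _ _ _ _ _ _ (h' 0) (h' 1)
    rw [det_fromBlocks_swap_cols hc, det_fromBlocks_swap_cols hc (wadaFox r ρ α 2 (r 0))] at this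
    exact this

end TwoRelators

/-! ### Fox derivatives of the relators of the knot -/

section KnotFox

open FreeGroup in
/-- The relation of the first arc is `w b v = b w b`, up to conjugation. -/
theorem knotRelators_zero_eq (n : ℕ) :
    knotRelators n 0 =
      (of 0 * (of 2)⁻¹ * (of 0)⁻¹) *
        ((of 2 * (of 1)⁻¹ * of 0 * (of 1)⁻¹) * (of 0 * (of 2 * (of 1)⁻¹) * of 0)⁻¹) *
        (of 0 * (of 2)⁻¹ * (of 0)⁻¹)⁻¹ := by
  have t3 : (3 : ℤ) = 2 * (1 : ℕ) + 1 := by norm_num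
  simp only [knotRelators, pretzelRelators, pretzelRel, pretzelBottom, knotTwists,
    Matrix.cons_val_zero, zero_add, Matrix.cons_val_one, t3, halfTwist_neg_two,
    halfTwist_two_mul_add_one,
    show (0 : Fin 3) - 1 = 2 from rfl, show (1 : Fin 3) - 1 = 0 from rfl, pow_one]
  group

open FreeGroup in
/-- The relation of the third arc is `x b a = v x b`, up to conjugation. -/
theorem pretzelRel_two_eq (n : ℕ) :
    pretzelRel (knotTwists n) 2 =
      (((of 2 * (of 1)⁻¹) ^ n)⁻¹ * of 1) *
        (((of 2 * (of 1)⁻¹) ^ n * of 0 * of 2) * ((of 1)⁻¹ * (of 2 * (of 1)⁻¹) ^ n * of 0)⁻¹) *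
        (((of 2 * (of 1)⁻¹) ^ n)⁻¹ * of 1)⁻¹ := by
  have hw : (of (1 : Fin 3) * (of 2)⁻¹) ^ n = ((of 2 * (of 1)⁻¹) ^ n)⁻¹ := by
    rw [← inv_pow, _root_.mul_inv_rev, inv_inv]
  simp only [pretzelRel, pretzelBottom, knotTwists, Matrix.cons_val_zero, Matrix.cons_val,
    halfTwist_neg_two, halfTwist_two_mul_add_one,
    show (2 : Fin 3) + 1 = 0 from rfl, show (0 : Fin 3) - 1 = 2 from rfl,
    show (2 : Fin 3) - 1 = 1 from rfl, hw]
  generalize (FreeGroup.of (2 : Fin 3) * (FreeGroup.of 1)⁻¹) ^ n = u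
  group

variable {n : ℕ} (ρ : KnotGroup n →* SpecialLinearGroup (Fin 2) ℂ)

/-- `Φ` on the free group, for a representation of the knot group into `SL₂(ℂ)`. -/
noncomputable abbrev knotPhi :
    FreeGroup (Fin 3) →* Matrix (Fin 2) (Fin 2) ℂ[T;T⁻¹] :=
  wadaGroup (knotRelators n) (SpecialLinearGroup.toGL.comp ρ) (abel n)

/-- The images under `Φ` of the Fox derivatives, for a representation into `SL₂(ℂ)`. -/
noncomputable abbrev knotFox (j : Fin 3) (g : FreeGroup (Fin 3)) :
    Matrix (Fin 2) (Fin 2) ℂ[T;T⁻¹] :=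
  wadaFox (knotRelators n) (SpecialLinearGroup.toGL.comp ρ) (abel n) j g

theorem knotFox_of (i j : Fin 3) : knotFox ρ j (FreeGroup.of i) = if i = j then 1 else 0 :=
  wadaFox_of _ _ _ i j

theorem knotFox_mul (j : Fin 3) (g h : FreeGroup (Fin 3)) :
    knotFox ρ j (g * h) = knotFox ρ j g + knotPhi ρ g * knotFox ρ j h :=
  wadaFox_mul _ _ _ j g h

theorem knotFox_inv (j : Fin 3) (g : FreeGroup (Fin 3)) :
    knotFox ρ j g⁻¹ = -(knotPhi ρ g⁻¹ * knotFox ρ j g) :=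
  wadaFox_inv _ _ _ j g

theorem knotFox_pow (j : Fin 3) (g : FreeGroup (Fin 3)) (k : ℕ) :
    knotFox ρ j (g ^ k) = (∑ i ∈ Finset.range k, knotPhi ρ g ^ i) * knotFox ρ j g :=
  wadaFox_pow _ _ _ j g k

open LaurentPolynomial in
theorem knotPhi_apply (g : FreeGroup (Fin 3)) :
    knotPhi ρ g = (T (Multiplicative.toAdd (abel n (PresentedGroup.mk _ g))) : ℂ[T;T⁻¹]) •
      (ρ (PresentedGroup.mk _ g) : Matrix (Fin 2) (Fin 2) ℂ).map C := rfl

open LaurentPolynomial in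
theorem det_knotPhi (g : FreeGroup (Fin 3)) :
    (knotPhi ρ g).det = T (2 * Multiplicative.toAdd (abel n (PresentedGroup.mk _ g))) := by
  rw [knotPhi_apply, det_smul, ← RingHom.mapMatrix_apply, ← RingHom.map_det,
    (ρ (PresentedGroup.mk _ g)).2, map_one, mul_one, Fintype.card_fin, T_pow]
  rfl

open LaurentPolynomial in
theorem knotPhi_two : knotPhi ρ (FreeGroup.of 2) =
    (T 1 : ℂ[T;T⁻¹]) • (ρ (genA n) : Matrix (Fin 2) (Fin 2) ℂ).map C := by
  have := knotPhi_apply ρ (FreeGroup.of 2)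
  rw [show PresentedGroup.mk (Set.range (knotRelators n)) (FreeGroup.of 2) = genA n from rfl,
    abel_genA] at this
  exact this

open LaurentPolynomial in
theorem knotPhi_zero : knotPhi ρ (FreeGroup.of 0) =
    (T 1 : ℂ[T;T⁻¹]) • (ρ (genB n) : Matrix (Fin 2) (Fin 2) ℂ).map C := by
  have := knotPhi_apply ρ (FreeGroup.of 0)
  rw [show PresentedGroup.mk (Set.range (knotRelators n)) (FreeGroup.of 0) = genB n from rfl,
    abel_genB] at this
  exact this

theorem abel_genY_one_inv (n : ℕ) : abel n (genY n 1)⁻¹ = Multiplicative.ofAdd 1 := by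
  simp [abel, genY]

open LaurentPolynomial in
theorem knotPhi_one_inv : knotPhi ρ (FreeGroup.of 1)⁻¹ =
    (T 1 : ℂ[T;T⁻¹]) • (ρ (genY n 1)⁻¹ : Matrix (Fin 2) (Fin 2) ℂ).map C := by
  have := knotPhi_apply ρ (FreeGroup.of 1)⁻¹
  rw [show PresentedGroup.mk (Set.range (knotRelators n)) (FreeGroup.of 1)⁻¹ =
      (genY n 1)⁻¹ from rfl,
    abel_genY_one_inv] at this
  exact this

theorem knotPhi_rel_zero : knotPhi ρ (knotRelators n 0) = 1 := wadaGroup_relator _ _ _ 0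

theorem knotPhi_rel_two : knotPhi ρ (pretzelRel (knotTwists n) 2) = 1 := by
  rw [knotPhi_apply, show PresentedGroup.mk (Set.range (knotRelators n))
    (pretzelRel (knotTwists n) 2) = 1 from pretzelRel_two _]
  simp

/-- The product of the relations of the three arcs is trivial, so that the second relator may be
replaced by the relation of the third arc. -/
theorem knotFox_rel_one (j : Fin 3) :
    knotFox ρ j (knotRelators n 1) =
      -knotFox ρ j (knotRelators n 0) - knotFox ρ j (pretzelRel (knotTwists n) 2) := by
  have e : knotRelators n 1 = (knotRelators n 0)⁻¹ * (pretzelRel (knotTwists n) 2)⁻¹ := by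
    rw [pretzelRel_prod, inv_inv, show pretzelRel (knotTwists n) 0 = knotRelators n 0 from rfl,
      inv_mul_cancel_left]
    rfl
  have h0 : knotPhi ρ (knotRelators n 0)⁻¹ = 1 := by
    have := wadaGroup_mul_inv (knotRelators n) (SpecialLinearGroup.toGL.comp ρ) (abel n)
      (knotRelators n 0)
    rwa [knotPhi_rel_zero, one_mul] at this
  have h2 : knotPhi ρ (pretzelRel (knotTwists n) 2)⁻¹ = 1 := by
    have := wadaGroup_mul_inv (knotRelators n) (SpecialLinearGroup.toGL.comp ρ) (abel n)
      (pretzelRel (knotTwists n) 2)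
    rwa [knotPhi_rel_two, one_mul] at this
  rw [e, knotFox_mul, knotFox_inv, knotFox_inv, h0, h2, one_mul, one_mul, one_mul, sub_eq_add_neg]

/-- The loop `y₂ y₁⁻¹` around the third column. -/
abbrev loopWord : FreeGroup (Fin 3) := FreeGroup.of 2 * (FreeGroup.of 1)⁻¹

/-- The word by which the relation of the first arc is conjugated. -/
abbrev conjZero : FreeGroup (Fin 3) :=
  FreeGroup.of 0 * (FreeGroup.of 2)⁻¹ * (FreeGroup.of 0)⁻¹

/-- The word by which the relation of the third arc is conjugated. -/
abbrev conjTwo (n : ℕ) : FreeGroup (Fin 3) := (loopWord ^ n)⁻¹ * FreeGroup.of 1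

theorem knotFox_rel_zero_eq (j : Fin 3) : knotFox ρ j (knotRelators n 0) =
    knotPhi ρ conjZero * (knotFox ρ j (loopWord * FreeGroup.of 0 * (FreeGroup.of 1)⁻¹) -
      knotFox ρ j (FreeGroup.of 0 * loopWord * FreeGroup.of 0)) := by
  have f := knotPhi_rel_zero ρ
  rw [knotRelators_zero_eq] at f
  have g := wadaFox_conj _ _ _ j _ _ _ f
  rwa [← knotRelators_zero_eq] at g

theorem knotFox_rel_two_eq (j : Fin 3) : knotFox ρ j (pretzelRel (knotTwists n) 2) =
    knotPhi ρ (conjTwo n) * (knotFox ρ j (loopWord ^ n * FreeGroup.of 0 * FreeGroup.of 2) -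
      knotFox ρ j ((FreeGroup.of 1)⁻¹ * loopWord ^ n * FreeGroup.of 0)) := by
  have f := knotPhi_rel_two ρ
  rw [pretzelRel_two_eq] at f
  have g := wadaFox_conj _ _ _ j _ _ _ f
  rwa [← pretzelRel_two_eq] at g

theorem knotFox_one_inv {j : Fin 3} (hj : j ≠ 1) : knotFox ρ j (FreeGroup.of 1)⁻¹ = 0 := by
  rw [knotFox_inv, knotFox_of, if_neg hj.symm, mul_zero, neg_zero]

theorem knotFox_zero_loopWord : knotFox ρ 0 loopWord = 0 := by
  rw [knotFox_mul, knotFox_of, if_neg (by decide), knotFox_one_inv ρ (by decide), mul_zero,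
    add_zero]

theorem knotFox_two_loopWord : knotFox ρ 2 loopWord = 1 := by
  rw [knotFox_mul, knotFox_of, if_pos rfl, knotFox_one_inv ρ (by decide), mul_zero, add_zero]

theorem knotFox_zero_rel_zero : knotFox ρ 0 (knotRelators n 0) = knotPhi ρ conjZero *
    (knotPhi ρ loopWord - 1 - knotPhi ρ (FreeGroup.of 0) * knotPhi ρ loopWord) := by
  rw [knotFox_rel_zero_eq, knotFox_mul, knotFox_mul, knotFox_mul _ _ (_ * _) (FreeGroup.of 0),
    knotFox_mul _ _ (FreeGroup.of 0), knotFox_zero_loopWord, knotFox_one_inv ρ (by decide),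
    knotFox_of, if_pos rfl, map_mul _ (FreeGroup.of 0)]
  refine congrArg (_ * ·) ?_
  simp only [mul_zero, mul_one, add_zero, zero_add]
  abel

theorem knotFox_two_rel_zero : knotFox ρ 2 (knotRelators n 0) = knotPhi ρ conjZero *
    (1 - knotPhi ρ (FreeGroup.of 0)) := by
  rw [knotFox_rel_zero_eq, knotFox_mul, knotFox_mul, knotFox_mul _ _ (_ * _) (FreeGroup.of 0),
    knotFox_mul _ _ (FreeGroup.of 0), knotFox_two_loopWord, knotFox_one_inv ρ (by decide),
    knotFox_of, if_neg (by decide)]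
  refine congrArg (_ * ·) ?_
  simp only [mul_zero, mul_one, add_zero, zero_add]

theorem knotFox_zero_rel_two : knotFox ρ 0 (pretzelRel (knotTwists n) 2) =
    knotPhi ρ (conjTwo n) *
      -((knotPhi ρ (FreeGroup.of 1)⁻¹ - 1) * knotPhi ρ (loopWord ^ n)) := by
  rw [knotFox_rel_two_eq, knotFox_mul, knotFox_mul, knotFox_mul _ _ (_ * _) (FreeGroup.of 0),
    knotFox_mul _ _ (FreeGroup.of 1)⁻¹, knotFox_pow, knotFox_zero_loopWord,
    knotFox_one_inv ρ (by decide), knotFox_of, if_pos rfl, knotFox_of, if_neg (by decide),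
    map_mul _ (FreeGroup.of 1)⁻¹]
  refine congrArg (_ * ·) ?_
  simp only [mul_zero, mul_one, add_zero, zero_add, sub_mul, one_mul, neg_sub]

theorem knotFox_two_rel_two : knotFox ρ 2 (pretzelRel (knotTwists n) 2) =
    knotPhi ρ (conjTwo n) *
      -((knotPhi ρ (FreeGroup.of 1)⁻¹ - 1) * (∑ i ∈ Finset.range n, knotPhi ρ loopWord ^ i) -
        knotPhi ρ (loopWord ^ n) * knotPhi ρ (FreeGroup.of 0)) := by
  rw [knotFox_rel_two_eq, knotFox_mul, knotFox_mul, knotFox_mul _ _ (_ * _) (FreeGroup.of 0),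
    knotFox_mul _ _ (FreeGroup.of 1)⁻¹, knotFox_pow, knotFox_two_loopWord,
    knotFox_one_inv ρ (by decide), knotFox_of, if_neg (by decide), knotFox_of, if_pos rfl,
    map_mul _ (loopWord ^ n)]
  refine congrArg (_ * ·) ?_
  simp only [mul_zero, mul_one, add_zero, zero_add, sub_mul, one_mul]
  abel

open LaurentPolynomial in
theorem det_knotPhi_conjZero : (knotPhi ρ conjZero).det = T (-2) := by
  have ab2 : abel n (PresentedGroup.mk _ (FreeGroup.of 2)) = Multiplicative.ofAdd 1 := abel_genA n
  have ab0 : abel n (PresentedGroup.mk _ (FreeGroup.of 0)) = Multiplicative.ofAdd 1 := abel_genB n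
  rw [det_knotPhi]
  simp only [map_mul, map_inv, ab0, ab2, toAdd_mul, toAdd_inv, toAdd_ofAdd]
  norm_num

open LaurentPolynomial in
theorem det_knotPhi_conjTwo : (knotPhi ρ (conjTwo n)).det = T (-4 * n - 2) := by
  have ab2 : abel n (PresentedGroup.mk _ (FreeGroup.of 2)) = Multiplicative.ofAdd 1 := abel_genA n
  have ab1 : abel n (PresentedGroup.mk _ (FreeGroup.of 1)) = (Multiplicative.ofAdd 1)⁻¹ := by
    rw [← abel_genY_one_inv n, map_inv, inv_inv]
    rfl
  rw [det_knotPhi]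
  simp only [map_mul, map_inv, map_pow, ab1, ab2, toAdd_mul, toAdd_inv, toAdd_pow, toAdd_ofAdd,
    nsmul_eq_mul]
  refine congrArg _ ?_
  ring

open LaurentPolynomial in
/-- The determinant of the matrix of Fox derivatives with the column of `y₁` deleted. The second
relator is replaced by the relation of the third arc at the bottom, and both are replaced by
conjugates. -/
theorem det_wadaMatrix_one {A B V W X : Matrix (Fin 2) (Fin 2) ℂ[T;T⁻¹]}
    (hA : (ρ (genA n) : Matrix (Fin 2) (Fin 2) ℂ).map C = A)
    (hB : (ρ (genB n) : Matrix (Fin 2) (Fin 2) ℂ).map C = B)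
    (hV : (ρ (genY n 1)⁻¹ : Matrix (Fin 2) (Fin 2) ℂ).map C = V)
    (hW : A * V = W) (hX : W ^ n = X) :
    (wadaMatrix (knotRelators n) (SpecialLinearGroup.toGL.comp ρ) (abel n) 1).det =
      T (-4 * n - 4) *
        (fromBlocks ((T 1 : ℂ[T;T⁻¹]) ^ 2 • W - 1 - (T 1 : ℂ[T;T⁻¹]) ^ 3 • (B * W))
          (1 - (T 1 : ℂ[T;T⁻¹]) • B)
          (((T 1 : ℂ[T;T⁻¹]) • V - 1) * ((T 1 : ℂ[T;T⁻¹]) ^ (2 * n) • X))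
          (((T 1 : ℂ[T;T⁻¹]) • V - 1) *
            (∑ i ∈ Finset.range n, ((T 1 : ℂ[T;T⁻¹]) ^ 2 • W) ^ i) -
              (T 1 * (T 1 : ℂ[T;T⁻¹]) ^ (2 * n)) • (X * B))).det := by
  have p2 := (knotPhi_two ρ).trans (congrArg _ hA)
  have p0 := (knotPhi_zero ρ).trans (congrArg _ hB)
  have p1 := (knotPhi_one_inv ρ).trans (congrArg _ hV)
  have pw : knotPhi ρ loopWord = (T 1 : ℂ[T;T⁻¹]) ^ 2 • W := by
    rw [map_mul, p2, p1, smul_mul_assoc, mul_smul_comm, hW, smul_smul, sq]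
  have pwn : knotPhi ρ (loopWord ^ n) = (T 1 : ℂ[T;T⁻¹]) ^ (2 * n) • X := by
    rw [map_pow, pw, smul_pow, hX, pow_mul]
  have hBW : (T 1 : ℂ[T;T⁻¹]) ^ 3 • (B * W) =
      (T 1 : ℂ[T;T⁻¹]) • B * ((T 1 : ℂ[T;T⁻¹]) ^ 2 • W) := by
    rw [smul_mul_smul_comm, ← pow_succ']
  have hXB : (T 1 * (T 1 : ℂ[T;T⁻¹]) ^ (2 * n)) • (X * B) =
      (T 1 : ℂ[T;T⁻¹]) ^ (2 * n) • X * ((T 1 : ℂ[T;T⁻¹]) • B) := by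
    rw [smul_mul_smul_comm, mul_comm (T 1 : ℂ[T;T⁻¹])]
  have k00 := knotFox_zero_rel_zero ρ
  have k02 := knotFox_two_rel_zero ρ
  have k20 := knotFox_zero_rel_two ρ
  have k22 := knotFox_two_rel_two ρ
  rw [pw, p0] at k00
  rw [p0] at k02
  rw [p1, pwn] at k20
  rw [p1, pwn, pw, p0] at k22
  have e := det_fromBlocks_of_rows k00 k02 k20 k22 (knotFox_rel_one ρ 0) (knotFox_rel_one ρ 2)
  rw [det_knotPhi_conjZero, det_knotPhi_conjTwo, ← T_add,
    show (-2 : ℤ) + (-4 * n - 2) = -4 * n - 4 by ring] at e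
  rw [hBW, hXB, det_wadaMatrix]
  exact e

end KnotFox

/-! ### The polynomial with the coefficients `λ_i` -/

section Coefficients

variable {n : ℕ} {m s : ℂ}

theorem bigH_eq (n : ℕ) (m s : ℂ) : bigH n m s =
    1 - m ^ 2 * s + m ^ 2 * s * s ^ (2 * n) - s ^ 2 * s ^ (2 * n) := by
  unfold bigH
  ring

theorem evenConst_eq (hs : s ≠ 0) (hα : alpha n m s ≠ 0) (hβ : beta n m s ≠ 0)
    (hH : bigH n m s ≠ 0) :
    evenConst m s (s ^ (2 * n)) (beta n m s / (s * alpha n m s)) =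
      (etaOne n m s + etaTwo n m s) / (bigH n m s * beta n m s) := by
  unfold evenConst etaOne etaTwo
  rw [← bigH_eq]
  generalize alpha n m s = α at *
  generalize beta n m s = β at *
  generalize bigH n m s = H at *
  field_simp
  ring

theorem middleConst_eq_etaOne (hs : s ≠ 0) (hα : alpha n m s ≠ 0) (hβ : beta n m s ≠ 0)
    (hH : bigH n m s ≠ 0) :
    middleConst m s (s ^ (2 * n)) (beta n m s / (s * alpha n m s)) =
      -((s ^ 2 - 1) * etaOne n m s / (bigH n m s * beta n m s)) := by
  unfold middleConst etaOne
  rw [← bigH_eq]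
  generalize alpha n m s = α at *
  generalize beta n m s = β at *
  generalize bigH n m s = H at *
  field_simp
  ring

theorem coeffLambda_two_mul {c : ℂ} (hm : m ≠ 0) (hs : s ≠ 0) (hβ : beta n m s ≠ 0)
    (hH : bigH n m s ≠ 0)
    (hc : c = (etaOne n m s + etaTwo n m s) / (bigH n m s * beta n m s)) (k : ℕ) :
    coeffLambda n m s (2 * k) =
      (m + m⁻¹) * (s ^ (k + 1) - (s ^ (k + 2) - s⁻¹ ^ k) * c) := by
  have hk : 2 * k + 1 ≠ 2 * n := by omega
  have hsk := pow_ne_zero k hs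
  rw [coeffLambda, if_neg hk, if_pos (even_two_mul k), Nat.mul_div_cancel_left k two_pos, hc,
    inv_pow, pow_succ s k, pow_add s k 2]
  generalize etaOne n m s + etaTwo n m s = η at *
  generalize beta n m s = β at *
  generalize bigH n m s = H at *
  generalize s ^ k = z at *
  field_simp
  ring

theorem coeffLambda_two_mul_add_one {d : ℂ} (hs : s ≠ 0) (hβ : beta n m s ≠ 0)
    (hH : bigH n m s ≠ 0)
    (hd : d = -((s ^ 2 - 1) * etaOne n m s / (bigH n m s * beta n m s))) (k : ℕ) :
    coeffLambda n m s (2 * k + 1) =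
      (s - s⁻¹)⁻¹ * (s ^ k - s⁻¹ ^ k) + if k + 1 = n then d / s ^ n else 0 := by
  by_cases hk : k + 1 = n
  · have hk' : 2 * k + 1 + 1 = 2 * n := by omega
    have hk'' : n - 1 = k := by omega
    have hsn := pow_ne_zero n hs
    rw [coeffLambda, if_pos hk', if_pos hk, hk'', hd, inv_pow]
    generalize etaOne n m s = η at *
    generalize beta n m s = β at *
    generalize bigH n m s = H at *
    field_simp
    ring
  · have hk' : 2 * k + 1 + 1 ≠ 2 * n := by omega
    have hodd : ¬ Even (2 * k + 1) := by simp
    rw [coeffLambda, if_neg hk', if_neg hk, if_neg hodd, Nat.add_sub_cancel,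
      Nat.mul_div_cancel_left k two_pos, inv_pow, add_zero, div_eq_inv_mul]

open LaurentPolynomial in
/-- The coefficients sorted by parity. The additional term of the middle coefficient
`λ_{2n-1}` is split off. -/
theorem toLaurent_alexPoly {c d : ℂ} (hn : 1 ≤ n) (hm : m ≠ 0) (hs : s ≠ 0)
    (hβ : beta n m s ≠ 0) (hH : bigH n m s ≠ 0)
    (hc : c = (etaOne n m s + etaTwo n m s) / (bigH n m s * beta n m s))
    (hd : d = -((s ^ 2 - 1) * etaOne n m s / (bigH n m s * beta n m s))) :
    (alexPoly n m s).toLaurent =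
      1 + (∑ k ∈ Finset.range n,
        (C (m + m⁻¹) * (C s ^ (k + 1) - (C s ^ (k + 2) - C s⁻¹ ^ k) * C c) *
            ((T 1 : ℂ[T;T⁻¹]) ^ (2 * k + 3) + T 1 ^ (4 * n - 2 * k + 3))
          + C (s - s⁻¹)⁻¹ * (C s ^ k - C s⁻¹ ^ k) *
            ((T 1 : ℂ[T;T⁻¹]) ^ (2 * k + 4) + T 1 ^ (4 * n - 2 * k + 2))))
        + C (d / s ^ n) * ((T 1 : ℂ[T;T⁻¹]) ^ (2 * n + 2) + T 1 ^ (2 * n + 4))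
        + (T 1 : ℂ[T;T⁻¹]) ^ (4 * n + 6) := by
  have hlast : (∑ k ∈ Finset.range n,
      C (if k + 1 = n then d / s ^ n else 0) *
        ((T 1 : ℂ[T;T⁻¹]) ^ (2 * k + 4) + T 1 ^ (4 * n - 2 * k + 2))) =
      C (d / s ^ n) * ((T 1 : ℂ[T;T⁻¹]) ^ (2 * n + 2) + T 1 ^ (2 * n + 4)) := by
    rw [Finset.sum_eq_single_of_mem (n - 1) (Finset.mem_range.2 (by omega))]
    · rw [if_pos (by omega), show 2 * (n - 1) + 4 = 2 * n + 2 by omega,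
        show 4 * n - 2 * (n - 1) + 2 = 2 * n + 4 by omega]
    · intro k _ hk
      rw [if_neg (by omega), map_zero, zero_mul]
  have hassoc : ∀ x y z w : ℂ[T;T⁻¹], x + y + z + w = x + (y + z) + w := fun x y z w => by
    rw [add_assoc x]
  rw [alexPoly, map_add, map_add, map_one, map_sum, ← hlast, hassoc, ← Finset.sum_add_distrib,
    map_pow, Polynomial.toLaurent_X, sum_range_two_mul]
  congr 2
  refine Finset.sum_congr rfl fun k hk => ?_
  have hk := Finset.mem_range.1 hk
  rw [coeffLambda_two_mul hm hs hβ hH hc, coeffLambda_two_mul_add_one hs hβ hH hd]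
  simp only [map_mul, map_add, map_pow, map_sub, Polynomial.toLaurent_C, Polynomial.toLaurent_X]
  rw [show 2 * k + 1 + 3 = 2 * k + 4 by ring,
    show 4 * n - (2 * k + 1) + 3 = 4 * n - 2 * k + 2 by omega]
  ring

open Polynomial in
theorem alexPoly_monic_natDegree (n : ℕ) (m s : ℂ) :
    (alexPoly n m s).Monic ∧ (alexPoly n m s).natDegree = 4 * n + 6 := by
  have hdeg : (1 + ∑ i ∈ Finset.range (2 * n),
      C (coeffLambda n m s i) * (X ^ (i + 3) + X ^ (4 * n - i + 3)) : ℂ[X]).degree <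
        ((4 * n + 6 : ℕ) : WithBot ℕ) := by
    rw [← mem_degreeLT]
    refine Submodule.add_mem _ ?_ (Submodule.sum_mem _ fun i hi => ?_)
    · rw [mem_degreeLT, degree_one]
      exact_mod_cast Nat.succ_pos _
    · have hi := Finset.mem_range.1 hi
      rw [← smul_eq_C_mul]
      refine Submodule.smul_mem _ _ (Submodule.add_mem _ ?_ ?_) <;>
      · rw [mem_degreeLT, degree_X_pow]
        exact_mod_cast (by omega)
  have hX : (X ^ (4 * n + 6) : ℂ[X]).degree = ((4 * n + 6 : ℕ) : WithBot ℕ) := degree_X_pow _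
  constructor
  · exact (monic_X_pow _).add_of_right (by rwa [hX])
  · refine natDegree_eq_of_degree_eq_some ?_
    rw [alexPoly, degree_add_eq_right_of_degree_lt (by rwa [hX]), hX]

end Coefficients

/-! ### The matrices of `ρ_m` -/

section Matrices

variable {n : ℕ} {m s : ℂ}

theorem matA_eq (n : ℕ) (m s : ℂ) : matA n m s = repA m s (s ^ (2 * n)) := by
  rw [matA, repA, pow_succ' s]

theorem matB_eq (hm : m ≠ 0) (hs : s ≠ 0) (hα : alpha n m s ≠ 0) (hβ : beta n m s ≠ 0) :
    matB n m s = repB m (beta n m s / (s * alpha n m s)) := by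
  rw [matB, repB, smul_of]
  simp only [smul_cons, smul_empty, smul_eq_mul]
  generalize alpha n m s = α at *
  generalize beta n m s = β at *
  apply fin_two_eq <;> field_simp
  ring

theorem matX_eq (n : ℕ) (s : ℂ) : matX n s = repX s (s ^ (2 * n)) (s ^ n) := by
  rw [matX, repX, pow_succ' s]

end Matrices

/-! ### The twisted Alexander polynomial -/

section Laurent

open LaurentPolynomial

theorem toLaurent_ne_zero_of_coeff {P : Polynomial ℂ} (h : P.coeff 0 = 1) :
    P.toLaurent ≠ 0 := by
  rw [Polynomial.toLaurent_ne_zero]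
  rintro rfl
  simp at h

theorem quartic_ne_zero (c : ℂ) : (T 1 : ℂ[T;T⁻¹]) ^ 4 - C c * T 1 ^ 2 + 1 ≠ 0 := by
  have h : (Polynomial.X ^ 4 - Polynomial.C c * Polynomial.X ^ 2 + 1).coeff 0 = 1 := by simp
  simpa using toLaurent_ne_zero_of_coeff h

theorem quadratic_ne_zero (c : ℂ) : (T 1 : ℂ[T;T⁻¹]) ^ 2 - C c * T 1 + 1 ≠ 0 := by
  have h : (Polynomial.X ^ 2 - Polynomial.C c * Polynomial.X + 1).coeff 0 = 1 := by simp
  simpa using toLaurent_ne_zero_of_coeff h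

/-- Comparison of the coefficients of `t³`, `t⁶`, `t⁵` and `t⁴` in the part of the determinant
linear in `t ^ (2 n)`, see `quadratic_mul_palindromic`. -/
theorem IsParam.coefficient_identities {m s u p q : ℂ} (h : IsParam m s u p) (hq : q ^ 2 = u) :
    (m + m⁻¹) * (middleConst m s u p - (u * s + (1 - u * s ^ 2) * evenConst m s u p)) / q
        - (m + m⁻¹) * (middleConst m s u p / q) =
      -((m + m⁻¹) * (q * (s - s ^ 2 * evenConst m s u p) + q⁻¹ * evenConst m s u p)) ∧
    middleConst m s u p / q - (m + m⁻¹) *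
        ((m + m⁻¹) * (middleConst m s u p - (u * s + (1 - u * s ^ 2) * evenConst m s u p)) / q) =
      middleConst m s u p / q * (1 - (s + s⁻¹)) + (s - s⁻¹)⁻¹ * (s⁻¹ - 1) * (q + s * q⁻¹) ∧
    (m + m⁻¹) * (s - (s ^ 2 - 1) * evenConst m s u p) * (middleConst m s u p / q) +
        (m + m⁻¹) * (middleConst m s u p - (u * s + (1 - u * s ^ 2) * evenConst m s u p)) / q =
      2 * (m + m⁻¹) * (q * (1 - s * evenConst m s u p) + q⁻¹ * (s * evenConst m s u p)) ∧
    (m + m⁻¹) * (s - (s ^ 2 - 1) * evenConst m s u p) *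
        ((m + m⁻¹) * (middleConst m s u p - (u * s + (1 - u * s ^ 2) * evenConst m s u p)) / q)
        - (s⁻¹ * q + s * q⁻¹) - (s + s⁻¹) * (middleConst m s u p / q) =
      middleConst m s u p / q * (1 - (s + s⁻¹)) + (s - s⁻¹)⁻¹ * (s⁻¹ - 1) * (q + s * q⁻¹) := by
  have hm := h.m_ne
  have hs := h.s_ne
  have h1 := h.add_ne
  have h2 := h.sub_ne
  have e2 := h.middleConst_eq
  have e3 := h.quintic_coeff_eq
  have e4 := h.quartic_coeff_eq
  have hq0 : q ≠ 0 := fun h0 => h.u_ne (by rw [← hq, h0]; ring)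
  have hν : (s - s⁻¹)⁻¹ * (s⁻¹ - 1) = -1 / (s + 1) := by
    have : s - s⁻¹ = (s + 1) * (s - 1) / s := by field_simp; ring
    rw [this]
    field_simp
    ring
  rw [hν]
  generalize evenConst m s u p = c at *
  generalize middleConst m s u p = d at *
  subst hq
  refine ⟨?_, ?_, ?_, ?_⟩
  · field_simp
    ring
  · linear_combination (norm := (field_simp; ring)) 1 / q * e2
  · linear_combination (norm := (field_simp; ring)) 1 / q * e3
  · linear_combination (norm := (field_simp; ring)) 1 / q * e4

/-- The determinant of the Fox matrix is the denominator times the polynomial with the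
coefficients `λ_i`: after multiplication by `t⁴ - (s + s⁻¹) t² + 1`, `KnotMatrices.det_blocks` and
`quadratic_mul_palindromic` agree. -/
theorem det_blocks_eq {n : ℕ} (hn : 1 ≤ n) {m s : ℂ} (hm : m ≠ 0) (hs : s ≠ 0)
    (hroot : rZero n m s = 0) (hα : alpha n m s ≠ 0) (hβ : beta n m s ≠ 0)
    (hq : s ^ (2 * n + 1) + 1 ≠ 0) (hH : bigH n m s ≠ 0)
    {B V W X : Matrix (Fin 2) (Fin 2) ℂ[T;T⁻¹]}
    (hB : (repB m (beta n m s / (s * alpha n m s))).map C = B)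
    (hV : (repV m s (s ^ (2 * n))).map C = V) (hW : (repW s (s ^ (2 * n))).map C = W)
    (hX : (repX s (s ^ (2 * n)) (s ^ n)).map C = X) :
    (fromBlocks ((T 1 : ℂ[T;T⁻¹]) ^ 2 • W - 1 - (T 1 : ℂ[T;T⁻¹]) ^ 3 • (B * W))
          (1 - (T 1 : ℂ[T;T⁻¹]) • B)
          (((T 1 : ℂ[T;T⁻¹]) • V - 1) * ((T 1 : ℂ[T;T⁻¹]) ^ (2 * n) • X))
          (((T 1 : ℂ[T;T⁻¹]) • V - 1) *
            (∑ i ∈ Finset.range n, ((T 1 : ℂ[T;T⁻¹]) ^ 2 • W) ^ i) -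
              (T 1 * (T 1 : ℂ[T;T⁻¹]) ^ (2 * n)) • (X * B))).det =
      (T 1 ^ 2 - C (m + m⁻¹) * T 1 + 1) * (alexPoly n m s).toLaurent := by
  have h := IsParam.of_root hn hm hs hroot hα hβ hq hH
  have hc := evenConst_eq hs hα hβ hH
  have hd := middleConst_eq_etaOne hs hα hβ hH
  have hu : (s ^ n) ^ 2 = s ^ (2 * n) := by rw [← pow_mul, mul_comm]
  have hs' : s - s⁻¹ ≠ 0 := by
    have : s - s⁻¹ = (s + 1) * (s - 1) / s := by field_simp; ring
    rw [this]
    exact div_ne_zero (mul_ne_zero h.add_ne h.sub_ne) hs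
  have hS : (∑ i ∈ Finset.range n, ((T 1 : ℂ[T;T⁻¹]) ^ 2 • W) ^ i) *
      ((T 1 : ℂ[T;T⁻¹]) ^ 2 • W - 1) = (T 1 : ℂ[T;T⁻¹]) ^ (2 * n) • X - 1 := by
    rw [geom_sum_mul, smul_pow, ← pow_mul, ← hW, ← hX, ← repW_pow hs, Matrix.map_pow]
  have e1 := ((h.knotMatrices hu).map C).det_blocks (T 1) (T 1 ^ (2 * n))
    (∑ i ∈ Finset.range n, ((T 1 : ℂ[T;T⁻¹]) ^ 2 • W) ^ i) (isUnit_T 1) (by rw [hW, hX]; exact hS)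
  have hadj : ((repW s (s ^ (2 * n))).map C).adjugate =
      ((repW s (s ^ (2 * n))).adjugate.map C : Matrix (Fin 2) (Fin 2) ℂ[T;T⁻¹]) :=
    (RingHom.map_adjugate (C : ℂ →+* ℂ[T;T⁻¹]) _).symm
  rw [hadj] at e1
  simp only [← Matrix.map_mul, trace_map_fin_two, h.trace_BW, h.trace_XBV hu, h.trace_XB hu,
    IsParam.trace_adjugate_W_mul_X] at e1
  rw [show (repA m s (s ^ (2 * n))).trace = m + m⁻¹ by rw [repA, trace_fin_two_of],
    show (repW s (s ^ (2 * n))).trace = s + s⁻¹ by rw [repW, trace_fin_two_of],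
    Matrix.map_mul, Matrix.map_mul, hB, hV, hW, hX] at e1
  have e2 := quadratic_mul_palindromic n (C s) (C s⁻¹)
    (C (evenConst m s (s ^ (2 * n)) (beta n m s / (s * alpha n m s))))
    (C (middleConst m s (s ^ (2 * n)) (beta n m s / (s * alpha n m s)) / s ^ n))
    (C (s - s⁻¹)⁻¹) (C (m + m⁻¹)) (T 1 : ℂ[T;T⁻¹])
    (by rw [← map_mul, mul_inv_cancel₀ hs, map_one])
    (by rw [← map_sub, ← map_mul, inv_mul_cancel₀ hs', map_one])
  rw [← toLaurent_alexPoly hn hm hs hβ hH hc hd] at e2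
  obtain ⟨E₁, E₂, E₃, E₄⟩ := h.coefficient_identities hu
  generalize evenConst m s (s ^ (2 * n)) (beta n m s / (s * alpha n m s)) = c at *
  generalize middleConst m s (s ^ (2 * n)) (beta n m s / (s * alpha n m s)) / s ^ n = a at *
  generalize (m + m⁻¹) * (middleConst m s (s ^ (2 * n)) (beta n m s / (s * alpha n m s)) -
    (s ^ (2 * n) * s + (1 - s ^ (2 * n) * s ^ 2) * c)) / s ^ n = b at *
  rw [← map_pow (C : ℂ →+* ℂ[T;T⁻¹]) s n, ← map_pow (C : ℂ →+* ℂ[T;T⁻¹]) s⁻¹ n, inv_pow] at e2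
  generalize s ^ n = q at *
  refine mul_right_cancel₀ (quartic_ne_zero (s + s⁻¹)) ?_
  replace E₁ := congrArg (C : ℂ →+* ℂ[T;T⁻¹]) E₁
  replace E₂ := congrArg (C : ℂ →+* ℂ[T;T⁻¹]) E₂
  replace E₃ := congrArg (C : ℂ →+* ℂ[T;T⁻¹]) E₃
  replace E₄ := congrArg (C : ℂ →+* ℂ[T;T⁻¹]) E₄
  generalize (alexPoly n m s).toLaurent = Δ at *
  refine e1.trans ?_
  clear e1
  simp only [map_mul, map_add, map_sub, map_neg, map_pow, map_one, map_ofNat] at E₁ E₂ E₃ E₄ e2 ⊢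
  generalize (T 1 : ℂ[T;T⁻¹]) ^ (2 * n) = u at *
  linear_combination -(T 1 ^ 2 - (C m + C m⁻¹) * T 1 + 1) * e2
    + (T 1 ^ 2 - (C m + C m⁻¹) * T 1 + 1) * u *
      ((T 1 ^ 3 + T 1 ^ 7) * E₁ + T 1 ^ 6 * E₂ + T 1 ^ 5 * E₃ + T 1 ^ 4 * E₄)

variable {n : ℕ} (ρ : KnotGroup n →* SpecialLinearGroup (Fin 2) ℂ)

theorem det_smul_map_sub_one {M : Matrix (Fin 2) (Fin 2) ℂ} (hM : M.det = 1) :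
    ((T 1 : ℂ[T;T⁻¹]) • M.map C - 1).det = T 1 ^ 2 - C M.trace * T 1 + 1 := by
  rw [det_smul_sub_one, trace_map_fin_two]
  rw [← RingHom.mapMatrix_apply, ← RingHom.map_det, hM, map_one]

theorem wadaDenom_knot (j : Fin 3) :
    wadaDenom (knotRelators n) (SpecialLinearGroup.toGL.comp ρ) (abel n) j =
      (knotPhi ρ (FreeGroup.of j) - 1).det :=
  wadaDenom_eq _ _ _ j

theorem wadaDenom_zero : wadaDenom (knotRelators n) (SpecialLinearGroup.toGL.comp ρ) (abel n) 0 =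
    T 1 ^ 2 - C (ρ (genB n) : Matrix (Fin 2) (Fin 2) ℂ).trace * T 1 + 1 := by
  rw [wadaDenom_knot, knotPhi_zero, det_smul_map_sub_one (ρ (genB n)).2]

theorem wadaDenom_two : wadaDenom (knotRelators n) (SpecialLinearGroup.toGL.comp ρ) (abel n) 2 =
    T 1 ^ 2 - C (ρ (genA n) : Matrix (Fin 2) (Fin 2) ℂ).trace * T 1 + 1 := by
  rw [wadaDenom_knot, knotPhi_two, det_smul_map_sub_one (ρ (genA n)).2]

theorem wadaDenom_one : wadaDenom (knotRelators n) (SpecialLinearGroup.toGL.comp ρ) (abel n) 1 =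
    T (-2) * (T 1 ^ 2 -
      C (ρ (genY n 1)⁻¹ : Matrix (Fin 2) (Fin 2) ℂ).trace * T 1 + 1) := by
  have hdet : (knotPhi ρ (FreeGroup.of 1)).det = T (-2) := by
    have hab : abel n (PresentedGroup.mk _ (FreeGroup.of 1)) = (Multiplicative.ofAdd 1)⁻¹ := by
      rw [← abel_genY_one_inv n, map_inv, inv_inv]
      rfl
    rw [det_knotPhi, hab, toAdd_inv, toAdd_ofAdd, mul_neg, mul_one]
  have e : knotPhi ρ (FreeGroup.of 1) - 1 =
      knotPhi ρ (FreeGroup.of 1) * -(knotPhi ρ (FreeGroup.of 1)⁻¹ - 1) := by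
    rw [mul_neg, mul_sub, mul_one, ← map_mul, mul_inv_cancel, map_one, neg_sub]
  rw [wadaDenom_knot, e, det_mul, hdet, det_neg, Fintype.card_fin, neg_one_sq, one_mul,
    knotPhi_one_inv, det_smul_map_sub_one (ρ (genY n 1)⁻¹).2]

theorem wadaDenom_ne_zero (j : Fin 3) :
    wadaDenom (knotRelators n) (SpecialLinearGroup.toGL.comp ρ) (abel n) j ≠ 0 := by
  fin_cases j
  · exact (wadaDenom_zero ρ).trans_ne (quadratic_ne_zero _)
  · exact (wadaDenom_one ρ).trans_ne (mul_ne_zero (isUnit_T _).ne_zero (quadratic_ne_zero _))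
  · exact (wadaDenom_two ρ).trans_ne (quadratic_ne_zero _)

end Laurent

/-- A representation with the prescribed values on `a`, `b`, `x`; its value on `y₁⁻¹` is also
known. -/
theorem exists_isRhoM {n : ℕ} (hn : 1 ≤ n) {m s : ℂ} (hm : m ≠ 0) (hs : s ≠ 0)
    (hroot : rZero n m s = 0) (hα : alpha n m s ≠ 0) (hβ : beta n m s ≠ 0)
    (hq : s ^ (2 * n + 1) + 1 ≠ 0) (hH : bigH n m s ≠ 0) :
    ∃ ρ : KnotGroup n →* SpecialLinearGroup (Fin 2) ℂ, IsRhoM n m s ρ ∧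
      (ρ (genY n 1)⁻¹ : Matrix (Fin 2) (Fin 2) ℂ) = repV m s (s ^ (2 * n)) := by
  have hu : (s ^ n) ^ 2 = s ^ (2 * n) := by rw [← pow_mul, mul_comm]
  obtain ⟨ρ, ha, hb, hx, hv⟩ :=
    ((IsParam.of_root hn hm hs hroot hα hβ hq hH).knotMatrices hu).exists_rep (repW_pow hs n)
  exact ⟨ρ, ⟨ha.trans (matA_eq n m s).symm, hb.trans (matB_eq hm hs hα hβ).symm,
    hx.trans (matX_eq n s).symm⟩, hv⟩

theorem IsRhoM.unique {n : ℕ} {m s : ℂ} {ρ ρ' : KnotGroup n →* SpecialLinearGroup (Fin 2) ℂ}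
    (h : IsRhoM n m s ρ) (h' : IsRhoM n m s ρ') : ρ = ρ' :=
  hom_ext_of_gen (Subtype.ext (h.1.trans h'.1.symm)) (Subtype.ext (h.2.1.trans h'.2.1.symm))
    (Subtype.ext (h.2.2.trans h'.2.2.symm))

open LaurentPolynomial in
/-- The quotient for the generator `y₁`, with the denominator multiplied out. -/
theorem IsRhoM.det_wadaMatrix_one_eq {n : ℕ} (hn : 1 ≤ n) {m s : ℂ} (hm : m ≠ 0) (hs : s ≠ 0)
    (hroot : rZero n m s = 0) (hα : alpha n m s ≠ 0) (hβ : beta n m s ≠ 0)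
    (hq : s ^ (2 * n + 1) + 1 ≠ 0) (hH : bigH n m s ≠ 0)
    {ρ : KnotGroup n →* SpecialLinearGroup (Fin 2) ℂ} (h : IsRhoM n m s ρ) :
    (wadaMatrix (knotRelators n) (SpecialLinearGroup.toGL.comp ρ) (abel n) 1).det =
      wadaDenom (knotRelators n) (SpecialLinearGroup.toGL.comp ρ) (abel n) 1 *
        (T (2 * (-(2 * n + 1))) * (alexPoly n m s).toLaurent) := by
  obtain ⟨ρ', h', hv⟩ := exists_isRhoM hn hm hs hroot hα hβ hq hH
  obtain rfl := h'.unique h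
  have hu : (s ^ n) ^ 2 = s ^ (2 * n) := by rw [← pow_mul, mul_comm]
  have hK := (IsParam.of_root hn hm hs hroot hα hβ hq hH).knotMatrices hu
  have hW : (repA m s (s ^ (2 * n))).map (C : ℂ →+* ℂ[T;T⁻¹]) * (repV m s (s ^ (2 * n))).map C =
      (repW s (s ^ (2 * n))).map C := (hK.map C).mul_V
  have hX : (repW s (s ^ (2 * n))).map (C : ℂ →+* ℂ[T;T⁻¹]) ^ n =
      (repX s (s ^ (2 * n)) (s ^ n)).map C := by
    rw [← Matrix.map_pow, repW_pow hs]
  rw [det_wadaMatrix_one ρ' (congrArg (Matrix.map · C) (h'.1.trans (matA_eq n m s)))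
    (congrArg (Matrix.map · C) (h'.2.1.trans (matB_eq hm hs hα hβ)))
    (congrArg (Matrix.map · C) hv) hW hX,
    det_blocks_eq hn hm hs hroot hα hβ hq hH rfl rfl rfl rfl, wadaDenom_one, hv,
    show (repV m s (s ^ (2 * n))).trace = m + m⁻¹ by rw [repV, trace_fin_two_of]; ring,
    show (-4 * n - 4 : ℤ) = -2 + 2 * (-(2 * n + 1)) by ring, T_add]
  ring

end PretzelTAP

open PretzelTAP in
theorem theorem3p1 (n : ℕ) (hn : 1 ≤ n) (m s : ℂ) (hm : m ≠ 0) (hs : s ≠ 0)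
    (hroot : rZero n m s = 0) (hα : alpha n m s ≠ 0) (hβ : beta n m s ≠ 0)
    (hq : s ^ (2 * n + 1) + 1 ≠ 0) (hH : bigH n m s ≠ 0) :
    (∃! ρ : KnotGroup n →* Matrix.SpecialLinearGroup (Fin 2) ℂ, IsRhoM n m s ρ) ∧
    (∀ ρ : KnotGroup n →* Matrix.SpecialLinearGroup (Fin 2) ℂ, IsRhoM n m s ρ →
      ∃ e : ℤ, ∀ j : Fin 3,
        wadaDenom (knotRelators n) (Matrix.SpecialLinearGroup.toGL.comp ρ) (abel n) j ≠ 0 ∧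
        twistedAlexander (knotRelators n) (Matrix.SpecialLinearGroup.toGL.comp ρ) (abel n) j =
          algebraMap (LaurentPolynomial ℂ) (FractionRing (LaurentPolynomial ℂ))
            (LaurentPolynomial.T (2 * e) * Polynomial.toLaurent (alexPoly n m s))) ∧
    (alexPoly n m s).Monic ∧ (alexPoly n m s).natDegree = 4 * n + 6 := by
  -- The conjugating words of the relations contribute `t ^ (-4 n - 4)` to the determinant, and the
  -- generator `y₁`, a meridian oriented upwards, contributes `t ^ (-2)` to the denominator.
  refine ⟨?_, fun ρ hρ => ⟨-(2 * n + 1), fun j => ⟨wadaDenom_ne_zero ρ j, ?_⟩⟩,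
    alexPoly_monic_natDegree n m s⟩
  · obtain ⟨ρ, h, -⟩ := exists_isRhoM hn hm hs hroot hα hβ hq hH
    exact ⟨ρ, h, fun ρ' h' => h'.unique h⟩
  · have hd := wadaDenom_ne_zero ρ j
    have h1 := wadaDenom_ne_zero ρ 1
    have hj := det_wadaMatrix_mul_wadaDenom (knotRelators n)
      (Matrix.SpecialLinearGroup.toGL.comp ρ) (abel n) even_two j
    rw [hρ.det_wadaMatrix_one_eq hn hm hs hroot hα hβ hq hH, mul_assoc, mul_comm] at hj
    have hj' := mul_left_cancel₀ h1 hj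
    rw [twistedAlexander, hj', map_mul]
    exact mul_div_cancel_right₀ _
      ((map_ne_zero_iff _ (IsFractionRing.injective _ _)).2 hd)
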